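/- Let $*$ be a nonstandard extension, i.e. an assignment $X \mapsto {^*X}$, $f \mapsto {^*f}$ on sets and functions (in particular also on power sets, function sets, etc.) which satisfies the Transfer Principle. Internal sets are the members ${^*Y}_b$, $b \in {^*I}$, of extensions of families of sets $(Y_i)_{i \in I}$. Let $B$ be an internal Dedekind ring, i.e. the member $B = {^*A}_b$ of the extension of a family of commutative rings $(A_i)_{i\in I}$ at an element $b \in {^*I}$ lying in the extension of $\{ i \in I : A_i \text{ is a Dedekind domain, not a field}\}$. Let $L$ be the quotient field of $B$. Let $\mathcal{M}$ be the set of internal maximal ideals of $B$ and let $\mathcal{L}$ be the lattice of hyperfinite subsets of $\mathcal{M}$. The group of internal Weil divisors ${^*\bigoplus}_{\mathcal{M}} {^*\mathbb{Z}}$ is the group of internal functions $\mathcal{M} \to {^*\mathbb{Z}}$ which vanish outside a hyperfinite subset of $\mathcal{M}$. For $a \in B$ put $V(a) = \{\mathfrak{p} \in \mathcal{M} : a \in \mathfrak{p}\}$. For a filter $\mathcal{F}$ on $\mathcal{L}$, let $\left({^*\bigoplus}_{\mathcal{M}} {^*\mathbb{Z}}\right)/\mathcal{F}$ be the group of internal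 Weil divisors where two of them are identified if they coincide on a set belonging to $\mathcal{F}$, ordered by pointwise comparison on a set belonging to $\mathcal{F}$. Theorem. Let $\mathfrak{m}$ be a (not necessarily internal) maximal ideal of $B$. Then the localization $B_{\mathfrak{m}}$ is a valuation ring of $L$. The filter $\mathcal{F}$ on $\mathcal{L}$ generated by the sets $V(a)$, $0 \neq a \in \mathfrak{m}$ (that is, the set of all $H \in \mathcal{L}$ which contain $V(a_1) \cap \dots \cap V(a_n)$ for some $n \geq 1$ and nonzero $a_1, \dots, a_n \in \mathfrak{m}$) is an ultrafilter, i.e. a maximal proper filter on $\mathcal{L}$. The value group $G = L^{\times}/B_{\mathfrak{m}}^{\times}$ of $B_{\mathfrak{m}}$ (written additively, with $v(x) \geq 0$ if and only if $x \in B_{\mathfrak{m}}$) satisfies $$ G \cong \left( {^*\bigoplus}_{\mathcal{M}} {^*\mathbb{Z}} \right) / \ \mathcal{F} $$ as ordered groups. If $\mathfrak{m}$ is internal, then $\mathcal{F}$ is the principal ultrafilter generated by $\mathfrak{m}$, i.e. $\mathcal{F} = \{H \in \mathcal{L} : \mathfrak{m} \in H\}$, and $G \cong {^*\mathbb{Z}}$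 as ordered groups. -/

import Mathlib

universe u v

/-- A nonstandard extension `*`: every set `X` and every function `f : X → Y` gets an extension
`*X`, `*f : *X → *Y`, and the extension of sets and functions satisfies the Transfer Principle.

For `A ⊆ X` the subset `*A ⊆ *X` is the image of the extension of the inclusion.  Since any subset
of a (finite product of) set(s) is allowed as an atomic formula, Transfer for all formulas says that
`A ↦ *A` commutes with equality, negation, conjunction, substitution of terms and existential
quantification.  The fields below contain finite products, equality and negation; the remaining
clauses follow (`ext_inter`, `ext_preimage`, `ext_image`).  As power sets, sets of functions, sets of
finite subsets etc. are themselves sets, this covers higher-order statements. -/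
structure NonstandardExtension where
  /-- the extension `*X` of the set `X` -/
  obj : Type u → Type v
  /-- the extension `*f` of the function `f` -/
  map : ∀ {X Y : Type u}, (X → Y) → obj X → obj Y
  map_id : ∀ {X : Type u} (x : obj X), map id x = x
  map_comp : ∀ {X Y Z : Type u} (g : Y → Z) (f : X → Y) (x : obj X),
    map (g ∘ f) x = map g (map f x)
  nonempty_unit : Nonempty (obj PUnit.{u + 1})
  /-- `*(X × Y) = *X × *Y` -/
  pair_bijective : ∀ X Y : Type u,
    Function.Bijective (fun z : obj (X × Y) => (map Prod.fst z, map Prod.snd z))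
  /-- Transfer for equations: `*{a | f a = g a} = {x | *f x = *g x}` -/
  map_eq_map_iff : ∀ {X Y : Type u} (f g : X → Y) (x : obj X),
    map f x = map g x ↔ x ∈ Set.range (map (Subtype.val : {a // f a = g a} → X))
  /-- Transfer for negations: `*(X \ A) = *X \ *A` -/
  range_compl : ∀ {X : Type u} (A : Set X),
    Set.range (map (Subtype.val : {a // a ∉ A} → X)) =
      (Set.range (map (Subtype.val : {a // a ∈ A} → X)))ᶜ

namespace NonstandardExtension

variable (S : NonstandardExtension.{u, v})

/-- The extension `*A ⊆ *X` of a subset `A ⊆ X`. -/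
def ext {X : Type u} (A : Set X) : Set (S.obj X) :=
  Set.range (S.map (Subtype.val : {a // a ∈ A} → X))

section Basic

variable {S}

theorem map_injective {X Y : Type u} {f : X → Y} (hf : Function.Injective f) :
    Function.Injective (S.map f) := by
  intro x y h
  obtain ⟨p, hp⟩ := (S.pair_bijective X X).2 (x, y)
  obtain ⟨rfl, rfl⟩ : S.map Prod.fst p = x ∧ S.map Prod.snd p = y := by simpa using hp
  rw [← S.map_comp, ← S.map_comp, S.map_eq_map_iff] at h
  obtain ⟨q, rfl⟩ := h
  rw [← S.map_comp, ← S.map_comp]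
  congr 1
  funext a
  exact hf a.2

theorem mem_ext_of_forall {X : Type u} {A : Set X} (h : ∀ a, a ∈ A) (x : S.obj X) :
    x ∈ S.ext A :=
  ⟨S.map (fun a => ⟨a, h a⟩) x, by rw [← S.map_comp]; exact S.map_id x⟩

theorem map_mem_ext {X Y : Type u} {f : X → Y} {A : Set X} {C : Set Y}
    (h : ∀ a ∈ A, f a ∈ C) {x : S.obj X} (hx : x ∈ S.ext A) : S.map f x ∈ S.ext C := by
  obtain ⟨y, rfl⟩ := hx
  refine ⟨S.map (fun a => ⟨f a.1, h _ a.2⟩) y, ?_⟩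
  rw [← S.map_comp, ← S.map_comp]
  rfl

theorem ext_mono {X : Type u} {A C : Set X} (h : A ⊆ C) : S.ext A ⊆ S.ext C := by
  intro x hx
  simpa only [S.map_id] using map_mem_ext (f := id) h hx

theorem ext_compl {X : Type u} (A : Set X) : S.ext Aᶜ = (S.ext A)ᶜ := S.range_compl A

theorem ext_univ {X : Type u} : S.ext (Set.univ : Set X) = Set.univ :=
  Set.eq_univ_of_forall fun x => mem_ext_of_forall (fun _ => trivial) x

theorem ext_empty {X : Type u} : S.ext (∅ : Set X) = ∅ := by
  rw [← Set.compl_univ, ext_compl, ext_univ, Set.compl_univ]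

/-- Transfer for the substitution of terms. -/
theorem ext_preimage {X Y : Type u} (f : X → Y) (C : Set Y) :
    S.ext (f ⁻¹' C) = S.map f ⁻¹' S.ext C := by
  ext x
  refine ⟨fun hx => map_mem_ext (f := f) (fun _ h => h) hx, fun hx => ?_⟩
  by_contra hn
  have h1 : x ∈ S.ext (f ⁻¹' C)ᶜ := by rw [ext_compl]; exact hn
  have h2 : S.map f x ∈ S.ext Cᶜ := map_mem_ext (f := f) (fun _ h => h) h1
  rw [ext_compl] at h2
  exact h2 hx

/-- Transfer for conjunctions. -/
theorem ext_inter {X : Type u} (A C : Set X) : S.ext (A ∩ C) = S.ext A ∩ S.ext C := by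
  refine subset_antisymm (Set.subset_inter (ext_mono Set.inter_subset_left)
    (ext_mono Set.inter_subset_right)) ?_
  rintro _ ⟨⟨y, rfl⟩, hx⟩
  have hy : y ∈ S.ext ((Subtype.val : {a // a ∈ A} → X) ⁻¹' C) := by
    rw [ext_preimage]; exact hx
  exact map_mem_ext (f := Subtype.val) (C := A ∩ C) (fun a ha => And.intro a.2 ha) hy

theorem ext_union {X : Type u} (A C : Set X) : S.ext (A ∪ C) = S.ext A ∪ S.ext C := by
  rw [← compl_inj_iff, ← ext_compl, Set.compl_union, ext_inter, ext_compl, ext_compl,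
    Set.compl_union]

/-- Transfer for existential quantifiers. -/
theorem ext_image {X Y : Type u} (f : X → Y) (A : Set X) :
    S.ext (f '' A) = S.map f '' S.ext A := by
  refine subset_antisymm ?_ ?_
  · rintro _ ⟨y, rfl⟩
    choose g hg using fun a : {a // a ∈ f '' A} => a.2
    refine ⟨S.map g y, ?_, ?_⟩
    · exact map_mem_ext (A := Set.univ) (fun a _ => (hg a).1) (by rw [ext_univ]; trivial)
    · rw [← S.map_comp]
      congr 1
      funext a
      exact (hg a).2
  · rintro _ ⟨x, hx, rfl⟩
    exact map_mem_ext (C := f '' A) (fun a ha => Set.mem_image_of_mem f ha) hx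

end Basic

section Pair

/-- The identification `*(X × Y) = *X × *Y`. -/
noncomputable def pair {X Y : Type u} : S.obj (X × Y) ≃ S.obj X × S.obj Y :=
  Equiv.ofBijective _ (S.pair_bijective X Y)

/-- The extension `*f : *X × *Y → *Z` of a function of two variables. -/
noncomputable def map₂ {X Y Z : Type u} (f : X → Y → Z) (x : S.obj X) (y : S.obj Y) : S.obj Z :=
  S.map (fun p : X × Y => f p.1 p.2) (S.pair.symm (x, y))

/-- The element of `*X` given by an element of `X`. -/
noncomputable def const {X : Type u} (a : X) : S.obj X :=
  S.map (fun _ => a) S.nonempty_unit.some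

variable {S}

theorem pair_symm_map {W X Y : Type u} (g : W → X) (h : W → Y) (w : S.obj W) :
    S.pair.symm (S.map g w, S.map h w) = S.map (fun a => (g a, h a)) w := by
  rw [Equiv.symm_apply_eq]
  change _ = (S.map _ (S.map _ w), S.map _ (S.map _ w))
  rw [← S.map_comp, ← S.map_comp]
  rfl

theorem map₂_map_map {W X Y Z : Type u} (f : X → Y → Z) (g : W → X) (h : W → Y) (w : S.obj W) :
    S.map₂ f (S.map g w) (S.map h w) = S.map (fun a => f (g a) (h a)) w := by
  rw [map₂, pair_symm_map, ← S.map_comp]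
  rfl

theorem exists_pair {X Y : Type u} (x : S.obj X) (y : S.obj Y) :
    ∃ w : S.obj (X × Y), S.map Prod.fst w = x ∧ S.map Prod.snd w = y := by
  obtain ⟨w, hw⟩ := (S.pair_bijective X Y).2 (x, y)
  exact ⟨w, by simpa using hw⟩

theorem map_const_fun {W X : Type u} (a : X) (w : S.obj W) :
    S.map (fun _ => a) w = S.const a := by
  have h := (S.pair_bijective PUnit.{u + 1} PUnit.{u + 1}).2
    (S.map (fun _ => PUnit.unit) w, S.nonempty_unit.some)
  obtain ⟨z, hz⟩ := h
  obtain ⟨h1, h2⟩ : S.map Prod.fst z = S.map (fun _ => PUnit.unit) w ∧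
      S.map Prod.snd z = S.nonempty_unit.some := by simpa using hz
  have h3 : (Prod.fst : PUnit.{u + 1} × PUnit.{u + 1} → PUnit.{u + 1}) = Prod.snd := rfl
  rw [const, ← h2, ← h3, h1, ← S.map_comp]
  rfl

noncomputable instance {X : Type u} [AddCommGroup X] : AddCommGroup (S.obj X) :=
  letI : Add (S.obj X) := ⟨S.map₂ (· + ·)⟩
  letI : Zero (S.obj X) := ⟨S.const 0⟩
  letI : Neg (S.obj X) := ⟨S.map (fun a => -a)⟩
  have addm : ∀ {W : Type u} (f g : W → X) (w : S.obj W),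
      S.map f w + S.map g w = S.map (fun a => f a + g a) w := fun f g w => map₂_map_map _ f g w
  have zerom : ∀ {W : Type u} (w : S.obj W), (0 : S.obj X) = S.map (fun _ => 0) w :=
    fun w => (map_const_fun 0 w).symm
  have negm : ∀ {W : Type u} (f : W → X) (w : S.obj W),
      - S.map f w = S.map (fun a => - f a) w := fun f w => (S.map_comp _ f w).symm
  { add_assoc := by
      intro x y z
      obtain ⟨t, ht, rfl⟩ := exists_pair (S := S) x y
      obtain ⟨w, rfl, rfl⟩ := exists_pair (S := S) t z
      subst ht
      simp only [← S.map_comp, addm]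
      congr 1
      funext a
      exact add_assoc _ _ _
    zero_add := by
      intro x
      have := addm (fun _ => 0) id x
      rw [← zerom, S.map_id] at this
      rw [this]
      simp only [id_eq, zero_add]
      exact S.map_id x
    add_zero := by
      intro x
      have := addm id (fun _ => 0) x
      rw [← zerom, S.map_id] at this
      rw [this]
      simp only [id_eq, add_zero]
      exact S.map_id x
    add_comm := by
      intro x y
      obtain ⟨w, rfl, rfl⟩ := exists_pair (S := S) x y
      simp only [addm]
      congr 1
      funext a
      exact add_comm _ _
    neg_add_cancel := by
      intro x
      have := addm (fun a => -a) id x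
      rw [S.map_id] at this
      refine this.trans ?_
      rw [zerom x]
      congr 1
      funext a
      exact neg_add_cancel a
    nsmul := nsmulRec
    zsmul := zsmulRec }

/-- The extension of an order relation. -/
instance {X : Type u} [Preorder X] : Preorder (S.obj X) where
  le x y := S.pair.symm (x, y) ∈ S.ext {p : X × X | p.1 ≤ p.2}
  le_refl x := by
    have := pair_symm_map id id x
    rw [S.map_id] at this
    rw [this]
    exact map_mem_ext (A := Set.univ) (fun a _ => le_refl a) (by rw [ext_univ]; trivial)
  le_trans x y z := by
    obtain ⟨t, ht, rfl⟩ := exists_pair (S := S) x y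
    obtain ⟨w, rfl, rfl⟩ := exists_pair (S := S) t z
    subst ht
    simp only [← S.map_comp, pair_symm_map]
    intro h1 h2
    change w ∈ S.map _ ⁻¹' S.ext _ at h1 h2
    rw [← ext_preimage] at h1 h2
    have h3 : w ∈ S.ext _ ∩ S.ext _ := ⟨h1, h2⟩
    rw [← ext_inter] at h3
    refine map_mem_ext ?_ h3
    rintro a ⟨ha1, ha2⟩
    exact le_trans (show a.1.1 ≤ a.1.2 from ha1) ha2

theorem obj_add_def {X : Type u} [AddCommGroup X] (x y : S.obj X) :
    x + y = S.map₂ (· + ·) x y := rfl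

theorem obj_zero_def {X : Type u} [AddCommGroup X] : (0 : S.obj X) = S.const 0 := rfl

theorem obj_neg_def {X : Type u} [AddCommGroup X] (x : S.obj X) :
    -x = S.map (fun a => -a) x := rfl

end Pair

/-- The ordered group `*ℤ` of hyperintegers. -/
abbrev HyperInt : Type v := S.obj (ULift.{u} ℤ)

/-- The internal set `Y_b`: the family of sets `(Y i)_{i ∈ I}` extends to a family of internal sets
indexed by `*I`, and `Y_b` is its member at `b ∈ *I`.  (Every internal set arises in this way: it is
an element `b` of `*I` for a set `I` of sets; take for `Y` the tautological family.)  If `*` is an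
ultrapower and `b` is the class of a family `(i_n)`, then `Y_b` is the ultraproduct of the
`Y (i_n)`. -/
def Internal {I : Type u} (Y : I → Type u) (b : S.obj I) : Type v :=
  {y : S.obj (Σ i, Y i) // S.map Sigma.fst y = b}

namespace Internal

variable {S} {I : Type u} {b : S.obj I} {Y Z W T : I → Type u}

/-- The internal function `Y_b → Z_b` given by a family of functions. -/
def map (f : ∀ i, Y i → Z i) (y : Internal S Y b) : Internal S Z b :=
  ⟨S.map (fun p => ⟨p.1, f p.1 p.2⟩) y.1, by
    rw [← S.map_comp]; exact y.2⟩

/-- The internal element given by a family of elements. -/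
def const (c : ∀ i, Y i) : Internal S Y b :=
  ⟨S.map (fun i => ⟨i, c i⟩) b, by
    rw [← S.map_comp]; exact S.map_id b⟩

theorem map_map (g : ∀ i, Z i → W i) (f : ∀ i, Y i → Z i) (y : Internal S Y b) :
    map g (map f y) = map (fun i a => g i (f i a)) y :=
  Subtype.ext (by
    change S.map _ (S.map _ _) = _
    rw [← S.map_comp]; rfl)

theorem map_id (y : Internal S Y b) : map (fun _ a => a) y = y :=
  Subtype.ext (S.map_id y.1)

theorem map_const_fun (c : ∀ i, Z i) (y : Internal S Y b) :
    map (fun i _ => c i) y = const c := by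
  refine Subtype.ext ?_
  change S.map _ _ = S.map _ b
  conv_rhs => rw [← y.2, ← S.map_comp]
  rfl

theorem pair_bijective (Y Z : I → Type u) (b : S.obj I) : Function.Bijective
    (fun w : Internal S (fun i => Y i × Z i) b =>
      (map (fun _ p => p.1) w, map (fun _ p => p.2) w)) := by
  constructor
  · intro w w' h
    obtain ⟨h1, h2⟩ := Prod.mk.inj h
    replace h1 := congrArg Subtype.val h1
    replace h2 := congrArg Subtype.val h2
    refine Subtype.ext ?_
    let g : (Σ i, Y i × Z i) → (Σ i, Y i) × (Σ i, Z i) := fun p => (⟨p.1, p.2.1⟩, ⟨p.1, p.2.2⟩)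
    have hg : Function.Injective g := by
      rintro ⟨i, y, z⟩ ⟨j, y', z'⟩ h
      simp only [g, Prod.mk.injEq, Sigma.mk.injEq] at h
      obtain ⟨⟨rfl, h1⟩, -, h2⟩ := h
      cases h1
      cases h2
      rfl
    apply map_injective hg
    apply (S.pair_bijective _ _).1
    refine Prod.ext ?_ ?_
    · change S.map _ (S.map _ _) = S.map _ (S.map _ _)
      rw [← S.map_comp, ← S.map_comp]
      exact h1
    · change S.map _ (S.map _ _) = S.map _ (S.map _ _)
      rw [← S.map_comp, ← S.map_comp]
      exact h2
  · rintro ⟨⟨y, hy⟩, ⟨z, hz⟩⟩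
    obtain ⟨p, rfl, rfl⟩ := exists_pair (S := S) y z
    have h := hy.trans hz.symm
    rw [← S.map_comp, ← S.map_comp, S.map_eq_map_iff] at h
    obtain ⟨q, rfl⟩ := h
    let k : {a : (Σ i, Y i) × (Σ i, Z i) // (Sigma.fst ∘ Prod.fst) a = (Sigma.fst ∘ Prod.snd) a} →
        (Σ i, Y i × Z i) := fun a => ⟨a.1.1.1, a.1.1.2, cast (congrArg Z a.2.symm) a.1.2.2⟩
    refine ⟨⟨S.map k q, ?_⟩, ?_⟩
    · rw [← hy, ← S.map_comp, ← S.map_comp, ← S.map_comp]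
      rfl
    · refine Prod.ext (Subtype.ext ?_) (Subtype.ext ?_)
      · change S.map _ (S.map _ _) = S.map _ (S.map _ _)
        rw [← S.map_comp, ← S.map_comp]
        rfl
      · change S.map _ (S.map _ _) = S.map _ (S.map _ _)
        rw [← S.map_comp, ← S.map_comp]
        congr 1
        funext a
        obtain ⟨⟨⟨i, y⟩, ⟨j, z⟩⟩, e⟩ := a
        change i = j at e
        subst e
        rfl

/-- The identification `(Y × Z)_b = Y_b × Z_b`. -/
noncomputable def pair :
    Internal S (fun i => Y i × Z i) b ≃ Internal S Y b × Internal S Z b :=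
  Equiv.ofBijective _ (pair_bijective Y Z b)

theorem exists_pair (y : Internal S Y b) (z : Internal S Z b) :
    ∃ w : Internal S (fun i => Y i × Z i) b,
      map (fun _ p => p.1) w = y ∧ map (fun _ p => p.2) w = z := by
  obtain ⟨w, hw⟩ := (pair_bijective Y Z b).2 (y, z)
  exact ⟨w, by simpa using hw⟩

/-- The internal function `Y_b × Z_b → W_b` given by a family of functions. -/
noncomputable def map₂ (f : ∀ i, Y i → Z i → W i) (y : Internal S Y b) (z : Internal S Z b) :
    Internal S W b :=
  map (fun i p => f i p.1 p.2) (pair.symm (y, z))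

theorem pair_symm_map (g : ∀ i, T i → Y i) (h : ∀ i, T i → Z i) (w : Internal S T b) :
    pair.symm (map g w, map h w) = map (fun i a => (g i a, h i a)) w := by
  rw [Equiv.symm_apply_eq]
  change _ = (map _ (map _ w), map _ (map _ w))
  rw [map_map, map_map]

theorem map₂_map_map (f : ∀ i, Y i → Z i → W i) (g : ∀ i, T i → Y i) (h : ∀ i, T i → Z i)
    (w : Internal S T b) :
    map₂ f (map g w) (map h w) = map (fun i a => f i (g i a) (h i a)) w := by
  rw [map₂, pair_symm_map, map_map]

/-- The internal relation between `Y_b` and `Z_b` given by a family of relations. -/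
def Rel (R : ∀ i, Y i → Z i → Prop) (y : Internal S Y b) (z : Internal S Z b) : Prop :=
  (pair.symm (y, z)).1 ∈ S.ext {p : Σ i, Y i × Z i | R p.1 p.2.1 p.2.2}

theorem rel_map_map (R : ∀ i, Y i → Z i → Prop) (g : ∀ i, T i → Y i) (h : ∀ i, T i → Z i)
    (w : Internal S T b) :
    Rel R (map g w) (map h w) ↔ w.1 ∈ S.ext {p : Σ i, T i | R p.1 (g p.1 p.2) (h p.1 p.2)} := by
  rw [Rel, pair_symm_map]
  change _ ∈ S.map _ ⁻¹' S.ext _ ↔ _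
  rw [← ext_preimage]
  rfl

/-- An internal ring: the member at `b` of the extension of a family of rings. -/
noncomputable instance {A : I → Type u} [∀ i, CommRing (A i)] : CommRing (Internal S A b) :=
  letI : Add (Internal S A b) := ⟨map₂ fun _ x y => x + y⟩
  letI : Mul (Internal S A b) := ⟨map₂ fun _ x y => x * y⟩
  letI : Neg (Internal S A b) := ⟨map fun _ x => -x⟩
  letI : Zero (Internal S A b) := ⟨const fun _ => 0⟩
  letI : One (Internal S A b) := ⟨const fun _ => 1⟩
  have addm : ∀ {T : I → Type u} (f g : ∀ i, T i → A i) (w : Internal S T b),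
      map f w + map g w = map (fun i a => f i a + g i a) w :=
    fun f g w => map₂_map_map _ f g w
  have mulm : ∀ {T : I → Type u} (f g : ∀ i, T i → A i) (w : Internal S T b),
      map f w * map g w = map (fun i a => f i a * g i a) w :=
    fun f g w => map₂_map_map _ f g w
  have negm : ∀ {T : I → Type u} (f : ∀ i, T i → A i) (w : Internal S T b),
      - map f w = map (fun i a => - f i a) w := fun f w => map_map _ f w
  have zerom : ∀ {T : I → Type u} (w : Internal S T b),
      (0 : Internal S A b) = map (fun i _ => 0) w := fun w => (map_const_fun _ w).symm
  have onem : ∀ {T : I → Type u} (w : Internal S T b),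
      (1 : Internal S A b) = map (fun i _ => 1) w := fun w => (map_const_fun _ w).symm
  CommRing.ofMinimalAxioms
    (by
      intro x y z
      obtain ⟨t, ht, rfl⟩ := exists_pair x y
      obtain ⟨w, rfl, rfl⟩ := exists_pair t z
      subst ht
      simp only [map_map, addm, add_assoc])
    (by
      intro x
      have := addm (fun _ _ => 0) (fun _ a => a) x
      rw [← zerom, map_id] at this
      rw [this]
      simp only [zero_add, map_id])
    (by
      intro x
      have := addm (fun _ a => -a) (fun _ a => a) x
      rw [← negm, map_id] at this
      rw [this, zerom x]
      simp only [neg_add_cancel])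
    (by
      intro x y z
      obtain ⟨t, ht, rfl⟩ := exists_pair x y
      obtain ⟨w, rfl, rfl⟩ := exists_pair t z
      subst ht
      simp only [map_map, mulm, mul_assoc])
    (by
      intro x y
      obtain ⟨w, rfl, rfl⟩ := exists_pair x y
      simp only [mulm, mul_comm])
    (by
      intro x
      have := mulm (fun _ _ => 1) (fun _ a => a) x
      rw [← onem, map_id] at this
      rw [this]
      simp only [one_mul, map_id])
    (by
      intro x y z
      obtain ⟨t, ht, rfl⟩ := exists_pair x y
      obtain ⟨w, rfl, rfl⟩ := exists_pair t z
      subst ht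
      simp only [map_map, mulm, addm, mul_add])

/-- The element of `*Z` given by an element of the member at `b` of a constant family. -/
def toStar {Z : Type u} (z : Internal S (fun _ : I => Z) b) : S.obj Z :=
  S.map Sigma.snd z.1

end Internal

section Divisors

variable {I : Type u} (A : I → Type u) [∀ i, CommRing (A i)] (b : S.obj I)

/-- The internal ring `B = A_b` is an internal Dedekind ring: it is obtained by transfer of the
notion of Dedekind domain, i.e. `b` belongs to the extension of the set of indices `i` such that
`A i` is a Dedekind domain.  As usual, fields are not counted as Dedekind domains here. -/
def IsInternalDedekind : Prop :=
  b ∈ S.ext {i | IsDedekindDomain (A i) ∧ ¬ IsField (A i)}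

variable {S A b}

/-- The internal subset of `B` with code `c` (a member at `b` of the family of power sets of the
`A i`) is `T`. -/
def Codes (c : S.Internal (fun i => Set (A i)) b) (T : Set (S.Internal A b)) : Prop :=
  ∀ x, x ∈ T ↔ Internal.Rel (fun _ x s => x ∈ s) x c

/-- Internal subsets of `B`. -/
def IsInternal (T : Set (S.Internal A b)) : Prop :=
  ∃ c : S.Internal (fun i => Set (A i)) b, Codes c T

variable (S A b)

/-- The set `𝓜` of internal maximal ideals of `B`. -/
def InternalMaximal : Type v :=
  {m : Ideal (S.Internal A b) // m.IsMaximal ∧ IsInternal (m : Set (S.Internal A b))}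

variable {S A b}

/-- Hyperfinite subsets of `𝓜`: their elements are the elements of a member at `b` of the family
of sets of finite sets of subsets of the `A i`. -/
def IsHyperfinite (H : Set (S.InternalMaximal A b)) : Prop :=
  ∃ h : S.Internal (fun i => Finset (Set (A i))) b, ∀ p : S.InternalMaximal A b,
    p ∈ H ↔ ∃ c : S.Internal (fun i => Set (A i)) b,
      Codes c (p.1 : Set (S.Internal A b)) ∧ Internal.Rel (fun _ s t => s ∈ t) c h

/-- Internal functions `𝓜 → *ℤ`: they are given by a member at `b` of the family of sets of
functions from the subsets of `A i` to `ℤ`. -/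
def IsInternalFun (f : S.InternalMaximal A b → S.HyperInt) : Prop :=
  ∃ φ : S.Internal (fun i => Set (A i) → ULift.{u} ℤ) b, ∀ (p : S.InternalMaximal A b)
    (c : S.Internal (fun i => Set (A i)) b), Codes c (p.1 : Set (S.Internal A b)) →
      f p = (Internal.map₂ (fun _ ψ s => ψ s) φ c).toStar

theorem isHyperfinite_empty : IsHyperfinite (∅ : Set (S.InternalMaximal A b)) := by
  refine ⟨Internal.const fun _ => ∅, fun p => ⟨fun h => h.elim, ?_⟩⟩
  rintro ⟨c, -, hc⟩
  rw [← Internal.map_const_fun _ c] at hc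
  have h2 := Internal.map_id c
  rw [← h2, Internal.map_map, Internal.rel_map_map] at hc
  simp only [Finset.notMem_empty] at hc
  have : {p : Σ i, Set (A i) | False} = ∅ := rfl
  rw [this, ext_empty] at hc
  exact hc

theorem IsHyperfinite.union {H K : Set (S.InternalMaximal A b)} (hH : IsHyperfinite H)
    (hK : IsHyperfinite K) : IsHyperfinite (H ∪ K) := by
  classical
  obtain ⟨h, hh⟩ := hH
  obtain ⟨k, hk⟩ := hK
  refine ⟨Internal.map₂ (fun _ s t => s ∪ t) h k, fun p => ?_⟩
  rw [Set.mem_union, hh, hk, ← exists_or]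
  refine exists_congr fun c => ?_
  rw [← and_or_left]
  refine and_congr_right fun _ => ?_
  obtain ⟨t, ht, rfl⟩ := Internal.exists_pair h k
  obtain ⟨w, rfl, rfl⟩ := Internal.exists_pair t c
  subst ht
  simp only [Internal.map_map, Internal.map₂_map_map, Internal.rel_map_map, Finset.mem_union]
  rw [← Set.mem_union, ← ext_union]
  rfl

variable (S A b)

/-- The group `*⨁_𝓜 *ℤ` of internal Weil divisors of `B`: internal functions `𝓜 → *ℤ` that vanish
outside a hyperfinite subset of `𝓜`. -/
def weilDivisors : AddSubgroup (S.InternalMaximal A b → S.HyperInt) where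
  carrier := {f | IsInternalFun f ∧ ∃ H, IsHyperfinite H ∧ ∀ p ∉ H, f p = 0}
  zero_mem' := by
    refine ⟨⟨Internal.const fun _ _ => 0, fun p c _ => ?_⟩, ∅, isHyperfinite_empty,
      fun _ _ => rfl⟩
    rw [← Internal.map_const_fun _ c]
    conv_rhs => rw [← Internal.map_id c, Internal.map_map, Internal.map₂_map_map]
    change _ = S.map _ (S.map _ _)
    rw [← S.map_comp]
    exact (map_const_fun _ _).symm
  add_mem' := by
    rintro f g ⟨⟨φ, hφ⟩, H, hH, hf⟩ ⟨⟨ψ, hψ⟩, K, hK, hg⟩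
    refine ⟨⟨Internal.map₂ (fun _ α β => α + β) φ ψ, fun p c hc => ?_⟩, H ∪ K, hH.union hK,
      fun p hp => ?_⟩
    · rw [Pi.add_apply, hφ p c hc, hψ p c hc]
      obtain ⟨t, ht, rfl⟩ := Internal.exists_pair φ ψ
      obtain ⟨w, rfl, rfl⟩ := Internal.exists_pair t c
      subst ht
      simp only [Internal.map_map, Internal.map₂_map_map]
      change S.map _ (S.map _ _) + S.map _ (S.map _ _) = S.map _ (S.map _ _)
      rw [← S.map_comp, ← S.map_comp, ← S.map_comp]
      exact map₂_map_map _ _ _ _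
    · rw [Set.mem_union, not_or] at hp
      rw [Pi.add_apply, hf p hp.1, hg p hp.2, add_zero]
  neg_mem' := by
    rintro f ⟨⟨φ, hφ⟩, H, hH, hf⟩
    refine ⟨⟨Internal.map (fun _ α => -α) φ, fun p c hc => ?_⟩, H, hH, fun p hp => ?_⟩
    · rw [Pi.neg_apply, hφ p c hc]
      obtain ⟨w, rfl, rfl⟩ := Internal.exists_pair φ c
      simp only [Internal.map_map, Internal.map₂_map_map]
      change -S.map _ (S.map _ _) = S.map _ (S.map _ _)
      rw [← S.map_comp, ← S.map_comp, obj_neg_def, ← S.map_comp]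
      rfl
    · rw [Pi.neg_apply, hf p hp, neg_zero]

/-- The lattice `𝓛` of hyperfinite subsets of `𝓜`, ordered by inclusion. -/
abbrev HyperfiniteSets : Type v := {H : Set (S.InternalMaximal A b) // IsHyperfinite H}

variable {S A b}

/-- `V(a) = {p ∈ 𝓜 | a ∈ p}`. -/
def zeroLocus (a : S.Internal A b) : Set (S.InternalMaximal A b) := {p | a ∈ p.1}

/-- `𝓕` is the ultrafilter on the lattice `𝓛` corresponding to the maximal ideal `m` of `B`:
it is a maximal proper filter, and it is the filter generated by the sets `V(a)`, for nonzero
`a ∈ m`. -/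
def IsUltrafilterOf (m : Ideal (S.Internal A b)) (𝓕 : Order.PFilter (S.HyperfiniteSets A b)) :
    Prop :=
  𝓕.dual.IsMaximal ∧
    ∀ H : S.HyperfiniteSets A b, H ∈ 𝓕 ↔ ∃ t : Finset (S.Internal A b), t.Nonempty ∧
      (∀ a ∈ t, a ∈ m ∧ a ≠ 0) ∧ ⋂ a ∈ t, zeroLocus a ⊆ H.1

/-- The internal Weil divisors that vanish on a set in `𝓕`. -/
def vanishing (𝓕 : Order.PFilter (S.HyperfiniteSets A b)) : AddSubgroup (S.weilDivisors A b) where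
  carrier := {f | ∃ H ∈ 𝓕, ∀ p ∈ H.1, f.1 p = 0}
  zero_mem' := by
    obtain ⟨H, hH⟩ := 𝓕.nonempty
    exact ⟨H, hH, fun _ _ => rfl⟩
  add_mem' := by
    rintro f g ⟨H, hH, hf⟩ ⟨K, hK, hg⟩
    obtain ⟨J, hJ, h1, h2⟩ := 𝓕.directed H hH K hK
    refine ⟨J, hJ, fun p hp => ?_⟩
    change f.1 p + g.1 p = 0
    rw [hf p (h1 hp), hg p (h2 hp), add_zero]
  neg_mem' := by
    rintro f ⟨H, hH, hf⟩
    refine ⟨H, hH, fun p hp => ?_⟩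
    change - f.1 p = 0
    rw [hf p hp, neg_zero]

/-- The group `(*⨁_𝓜 *ℤ) / 𝓕`: two internal Weil divisors are identified if they coincide on a set
in `𝓕`. -/
def DivisorsMod (𝓕 : Order.PFilter (S.HyperfiniteSets A b)) : Type v :=
  S.weilDivisors A b ⧸ vanishing 𝓕

namespace DivisorsMod

variable {𝓕 : Order.PFilter (S.HyperfiniteSets A b)}

noncomputable instance : AddCommGroup (DivisorsMod 𝓕) :=
  inferInstanceAs (AddCommGroup (S.weilDivisors A b ⧸ vanishing 𝓕))

/-- The class of an internal Weil divisor modulo `𝓕`. -/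
noncomputable def mk (f : S.weilDivisors A b) : DivisorsMod 𝓕 := QuotientAddGroup.mk f

theorem mk_eq_mk_iff (f g : S.weilDivisors A b) :
    (mk f : DivisorsMod 𝓕) = mk g ↔ ∃ H ∈ 𝓕, ∀ p ∈ H.1, f.1 p = g.1 p := by
  refine QuotientAddGroup.eq.trans ?_
  refine exists_congr fun H => and_congr_right fun _ => forall₂_congr fun p _ => ?_
  change -f.1 p + g.1 p = 0 ↔ _
  rw [neg_add_eq_zero]

/-- The order on `(*⨁_𝓜 *ℤ) / 𝓕`: pointwise comparison on a set in `𝓕`. -/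
instance : Preorder (DivisorsMod 𝓕) where
  le x y := ∃ f g : S.weilDivisors A b, mk f = x ∧ mk g = y ∧ ∃ H ∈ 𝓕, ∀ p ∈ H.1, f.1 p ≤ g.1 p
  le_refl x := by
    obtain ⟨f, rfl⟩ := QuotientAddGroup.mk_surjective x
    obtain ⟨H, hH⟩ := 𝓕.nonempty
    exact ⟨f, f, rfl, rfl, H, hH, fun _ _ => le_rfl⟩
  le_trans x y z := by
    rintro ⟨f, g, rfl, rfl, H, hH, h1⟩ ⟨g', k, hg, rfl, K, hK, h2⟩
    obtain ⟨J, hJ, h3⟩ := (mk_eq_mk_iff g' g).1 hg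
    obtain ⟨M, hM, hMH, hMK⟩ := 𝓕.directed H hH K hK
    obtain ⟨N, hN, hNM, hNJ⟩ := 𝓕.directed M hM J hJ
    refine ⟨f, k, rfl, rfl, N, hN, fun p hp => (h1 p (hMH (hNM hp))).trans ?_⟩
    rw [← h3 p (hNJ hp)]
    exact h2 p (hMK (hNM hp))

end DivisorsMod

end Divisors

end NonstandardExtension

/-- The value group of a valuation ring `R` with fraction field `L`, written additively: it is
`Lˣ / Rˣ`, with `0 ≤ v x` if and only if `x ∈ R`.  (The multiplicative `ValuationRing.ValueGroup`
includes the value of `0` and has the reverse order.) -/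
abbrev AddValueGroup (R L : Type*) [CommRing R] [IsDomain R] [ValuationRing R] [Field L]
    [Algebra R L] [IsFractionRing R L] : Type _ :=
  (Additive (ValuationRing.ValueGroup R L)ˣ)ᵒᵈ

/-! The ideal `m` may be external, so nothing can be transferred about `m` itself. What transfers
are elementwise statements about an ordinary Dedekind domain and its maximal ideals. Transfer takes
the form of Łoś's theorem: an internal element `w` defines an ultrafilter `w.ultra`, and a relation
between internal elements `map f w` holds iff it holds for the values of the `f` on a set of that
ultrafilter.

The ideal `m` is then a limit of internal maximal ideals `p` along the filter generated by the sets
`V(a)`: if `x ∈ m` then eventually `x ∈ p`, and if `x ∉ m` then eventually `x ∉ p`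
(`eventually_mem`, `eventually_notMem`). The filter is proper because, modulo a nonzero `a`,
finitely many elements can be merged into one (`exists_zeroLocus_inter_subset`), and a proper ideal
`(a, x)` lies in an internal maximal ideal.

Ultrafilter: for hyperfinite `H` and nonzero `a ∈ m`, write `1 = e + f` with `a ∣ e * f`, where `e`
vanishes on `V(a) ∩ H` and `f` on `V(a) \ H` (`exists_separation`). The prime ideal `m` contains `e`
or `f`, and this decides between `H` and its complement.

Valuation: for all `x`, `y` there are `s + t = 1` with `y ∣ s * x` and `x ∣ t * y`, and `s` or `t`
becomes a unit in `B_m`. The same relation shows that `x` divides `y` in `B_m` iff `ord_p x ≤ ord_p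
y` for almost all `p` (`eventually_order_le_iff`). Hence taking principal divisors embeds the value
group into the divisors modulo `𝓕`. It is onto because, by the Chinese remainder theorem, an
internal function agrees on `V(c)` with the difference of two principal divisors
(`exists_order_eq`). An internal `m` has two generators, so `V(a) ∩ V(x) = {m}`, and the order at
`m` is itself the valuation. -/

section Dedekind

/-! ### Maximal ideals and orders of vanishing in an ordinary Dedekind domain -/

variable {R : Type*} [CommRing R]

/-- The subset `s` of `R` is a maximal ideal. -/
def IsMaximalSet (s : Set R) : Prop := ∃ P : Ideal R, P.IsMaximal ∧ (P : Set R) = s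

/-- Maximality refers to all larger ideals, and its transfer would only see the internal ones. The
elementwise form, with invertibility modulo `s` as last clause, transfers verbatim. Variables are
bundled in pairs so that each clause has a single universal quantifier. -/
theorem isMaximalSet_iff (s : Set R) : IsMaximalSet s ↔
    0 ∈ s ∧ (∀ x : R × R, x.1 ∈ s → x.2 ∈ s → x.1 + x.2 ∈ s) ∧
      (∀ x : R × R, x.2 ∈ s → x.1 * x.2 ∈ s) ∧ 1 ∉ s ∧
      ∀ x : R, x ∉ s → ∃ y, 1 - x * y ∈ s := by
  constructor
  · rintro ⟨P, hP, rfl⟩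
    refine ⟨P.zero_mem, fun x => P.add_mem, fun x => P.mul_mem_left _,
      fun h => hP.ne_top ((Ideal.eq_top_iff_one P).2 h), fun x hx => ?_⟩
    obtain ⟨y, i, hi, h⟩ := hP.exists_inv hx
    refine ⟨y, ?_⟩
    rw [← h]
    simpa [mul_comm] using hi
  · rintro ⟨h0, hadd, hmul, h1, hinv⟩
    let P : Ideal R :=
      { carrier := s
        zero_mem' := h0
        add_mem' := fun {a c} ha hc => hadd (a, c) ha hc
        smul_mem' := fun a c hc => hmul (a, c) hc }
    refine ⟨P, ⟨⟨fun h => h1 ?_, fun J hJ => ?_⟩⟩, rfl⟩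
    · have : (1 : R) ∈ P := h ▸ Submodule.mem_top
      exact this
    · obtain ⟨x, hxJ, hxP⟩ := SetLike.exists_of_lt hJ
      obtain ⟨y, hy⟩ := hinv x hxP
      rw [Ideal.eq_top_iff_one]
      have := J.add_mem (hJ.le hy) (J.mul_mem_right y hxJ)
      simpa using this

/-- The order of vanishing of `a` at the maximal ideal `s`. -/
noncomputable def idealOrder (s : Set R) (a : R) : ℕ :=
  multiplicity (Ideal.span s) (Ideal.span {a})

theorem idealOrder_coe (P : Ideal R) (a : R) :
    idealOrder (P : Set R) a = multiplicity P (Ideal.span {a}) := by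
  rw [idealOrder, Ideal.span_eq]

variable [IsDedekindDomain R]

theorem idealOrder_eq_zero {s : Set R} (hs : IsMaximalSet s) {a : R} (ha : a ∉ s) :
    idealOrder s a = 0 := by
  obtain ⟨P, hP, rfl⟩ := hs
  rw [idealOrder_coe, multiplicity_eq_zero, Ideal.dvd_span_singleton]
  exact ha

theorem finite_isMaximalSet_mem {a : R} (ha : a ≠ 0) : {s | IsMaximalSet s ∧ a ∈ s}.Finite := by
  have h : Ideal.span {a} ≠ 0 := by simpa using ha
  refine ((Ideal.finite_factors h).image fun v => (v.asIdeal : Set R)).subset ?_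
  rintro _ ⟨⟨P, hP, rfl⟩, haP⟩
  refine ⟨⟨P, hP.isPrime, ?_⟩, ?_, rfl⟩
  · rintro rfl
    exact ha (by simpa using haP)
  · simpa [Ideal.dvd_span_singleton] using haP

/-- Dedekind domains are arithmetical. -/
theorem exists_add_eq_one_and_dvd_mul (x y : R) :
    ∃ c : R × R, c.1 + c.2 = 1 ∧ y ∣ c.1 * x ∧ x ∣ c.2 * y := by
  by_cases h0 : Ideal.span {x} ⊔ Ideal.span {y} = 0
  · obtain ⟨hx, hy⟩ : x = 0 ∧ y = 0 := by simpa [Ideal.zero_eq_bot] using h0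
    exact ⟨(1, 0), by simp, by simp [hx], by simp [hy]⟩
  obtain ⟨K, hK⟩ := Ideal.dvd_iff_le.2
    (le_sup_left : Ideal.span {x} ≤ Ideal.span {x} ⊔ Ideal.span {y})
  obtain ⟨J, hJ⟩ := Ideal.dvd_iff_le.2
    (le_sup_right : Ideal.span {y} ≤ Ideal.span {x} ⊔ Ideal.span {y})
  -- Dividing `(x)` and `(y)` by their gcd `(x) ⊔ (y)` leaves the coprime cofactors `K` and `J`.
  -- Then `s ∈ J` gives `s * x ∈ J * (x) = (y) * K ⊆ (y)`, and symmetrically for `t ∈ K`.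
  have h1 : J ⊔ K = ⊤ := by
    rw [sup_comm, ← Ideal.one_eq_top]
    refine mul_left_cancel₀ h0 ?_
    rw [Ideal.mul_sup, ← hK, ← hJ, mul_one]
  obtain ⟨s, hs, t, ht, h⟩ := Submodule.mem_sup.1 ((Ideal.eq_top_iff_one _).1 h1)
  refine ⟨(s, t), h, ?_, ?_⟩
  · have := Ideal.mul_mem_mul hs (Ideal.mem_span_singleton_self x)
    rw [hK, mul_left_comm, ← mul_assoc, ← hJ] at this
    exact Ideal.mem_span_singleton.1 (Ideal.mul_le_left this)
  · have := Ideal.mul_mem_mul ht (Ideal.mem_span_singleton_self y)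
    rw [hJ, mul_left_comm, ← mul_assoc, ← hK] at this
    exact Ideal.mem_span_singleton.1 (Ideal.mul_le_left this)

/-- An element `a ≠ 0` decomposes locally into a part supported in `H` and one supported
off `H`. -/
theorem exists_separation {a : R} (ha : a ≠ 0) (H : Finset (Set R)) :
    ∃ c : R × R, c.1 + c.2 = 1 ∧ a ∣ c.1 * c.2 ∧
      ∀ s, IsMaximalSet s → a ∈ s → (s ∈ H → c.1 ∈ s) ∧ (s ∉ H → c.2 ∈ s) := by
  classical
  have h : Ideal.span {a} ≠ 0 := by simpa using ha
  let F : Multiset (Ideal R) := UniqueFactorizationMonoid.normalizedFactors (Ideal.span {a})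
  -- The prime factors of `(a)` are sorted, with multiplicity, into those in `H` and those outside.
  let K : Ideal R := (F.filter fun P : Ideal R => (P : Set R) ∈ H).prod
  let J : Ideal R := (F.filter fun P : Ideal R => ¬ (P : Set R) ∈ H).prod
  have hKJ : K * J = Ideal.span {a} := by
    rw [← Multiset.prod_add, Multiset.filter_add_not]
    exact associated_iff_eq.1 (UniqueFactorizationMonoid.prod_normalizedFactors h)
  have hmax : ∀ Q ∈ F, Q.IsMaximal := fun Q hQ => by
    have hp := UniqueFactorizationMonoid.prime_of_normalized_factor Q hQ
    exact (Ideal.isPrime_of_prime hp).isMaximal hp.ne_zero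
  -- A maximal ideal containing both products would be a factor of both kinds.
  have hsup : K ⊔ J = ⊤ := by
    by_contra hne
    obtain ⟨P, hP, hle⟩ := Ideal.exists_le_maximal _ hne
    obtain ⟨Q, hQ, hQP⟩ := (hP.isPrime.multiset_prod_le).1 (le_sup_left.trans hle)
    obtain ⟨Q', hQ', hQP'⟩ := (hP.isPrime.multiset_prod_le).1 (le_sup_right.trans hle)
    rw [Multiset.mem_filter] at hQ hQ'
    rw [(hmax Q hQ.1).eq_of_le hP.ne_top hQP] at hQ
    rw [(hmax Q' hQ'.1).eq_of_le hP.ne_top hQP'] at hQ'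
    exact hQ'.2 hQ.2
  obtain ⟨e, he, f, hf, hef⟩ := Submodule.mem_sup.1 ((Ideal.eq_top_iff_one _).1 hsup)
  refine ⟨(e, f), hef, ?_, ?_⟩
  · rw [← Ideal.mem_span_singleton, ← hKJ]
    exact Ideal.mul_mem_mul he hf
  · rintro _ ⟨P, hP, rfl⟩ haP
    have hPF : P ∈ F := by
      have hP0 : P ≠ ⊥ := by
        rintro rfl
        exact ha (by simpa using haP)
      obtain ⟨Q, hQ, hPQ⟩ := UniqueFactorizationMonoid.exists_mem_normalizedFactors_of_dvd h
        (Ideal.prime_of_isPrime hP0 hP.isPrime).irreducible (Ideal.dvd_span_singleton.2 haP)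
      rwa [associated_iff_eq.1 hPQ]
    constructor
    · intro hPH
      exact Ideal.le_of_dvd (Multiset.dvd_prod (Multiset.mem_filter.2 ⟨hPF, hPH⟩)) he
    · intro hPH
      exact Ideal.le_of_dvd (Multiset.dvd_prod (Multiset.mem_filter.2 ⟨hPF, hPH⟩)) hf

/-- Modulo `a ≠ 0`, the ideal generated by `x` and `y` has a generator `x + c y`. -/
theorem exists_add_mul_mem_imp {a : R} (ha : a ≠ 0) (x y : R) :
    ∃ c : R, ∀ s, IsMaximalSet s → a ∈ s → x + c * y ∈ s → x ∈ s ∧ y ∈ s := by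
  classical
  -- Separating the maximal ideals that contain `a` but not `x`: there `e` vanishes, so `x + e * y ≡
  -- x` is nonzero; at the others over `a`, `e ≡ 1` and `x ≡ 0`, so `x + e * y ≡ y`.
  obtain ⟨⟨e, f⟩, hef, -, h⟩ := exists_separation ha
    ((finite_isMaximalSet_mem ha).toFinset.filter fun s => x ∉ s)
  refine ⟨e, fun s hs has hxy => ?_⟩
  have h' := h s hs has
  simp only [Finset.mem_filter, Set.Finite.mem_toFinset, Set.mem_ofPred_eq, hs, has, true_and,
    not_not] at h'
  obtain ⟨P, hP, rfl⟩ := hs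
  simp only [SetLike.mem_coe] at *
  by_cases hx : x ∈ P
  · refine ⟨hx, ?_⟩
    have h1 := P.sub_mem hxy hx
    have h2 := P.mul_mem_right y (h'.2 hx)
    have h3 := P.add_mem h1 h2
    rwa [add_sub_cancel_left, ← add_mul, hef, one_mul] at h3
  · have h1 := P.sub_mem hxy (P.mul_mem_right y (h'.1 hx))
    exact absurd (by simpa using h1) hx

omit [IsDedekindDomain R] in
theorem exists_isMaximalSet_mem_of_ne_one {a x : R}
    (h : ∀ c : R × R, c.1 * a + c.2 * x ≠ 1) :
    ∃ s, IsMaximalSet s ∧ a ∈ s ∧ x ∈ s := by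
  have hne : Ideal.span {a, x} ≠ ⊤ := by
    rw [Ne, Ideal.eq_top_iff_one, Ideal.mem_span_pair]
    rintro ⟨c, d, hcd⟩
    exact h (c, d) hcd
  obtain ⟨P, hP, hle⟩ := Ideal.exists_le_maximal _ hne
  exact ⟨P, ⟨P, hP, rfl⟩, hle (Ideal.subset_span (by simp)), hle (Ideal.subset_span (by simp))⟩

theorem idealOrder_pos {s : Set R} (hs : IsMaximalSet s) {a : R} (ha : a ∈ s) :
    0 < idealOrder s a := by
  obtain ⟨P, hP, rfl⟩ := hs
  -- This includes `a = 0`: an infinite `multiplicity` has default value `1`, which is positive.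
  rw [idealOrder_coe, Nat.pos_iff_ne_zero, Ne, multiplicity_eq_zero, not_not,
    Ideal.dvd_span_singleton]
  exact ha

omit [IsDedekindDomain R] in
theorem exists_ne_zero_forall_ne_one [Nontrivial R] (hR : ¬ IsField R) :
    ∃ a : R, a ≠ 0 ∧ ∀ c : R, a * c ≠ 1 := by
  by_contra! h
  exact hR ⟨⟨0, 1, zero_ne_one⟩, mul_comm, fun ha => h _ ha⟩

variable (hR : ¬ IsField R)
include hR

theorem prime_of_isMaximal {P : Ideal R} (hP : P.IsMaximal) : Prime P :=
  Ideal.prime_of_isPrime (Ring.ne_bot_of_isMaximal_of_not_isField hP hR) hP.isPrime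

theorem finiteMultiplicity_of_isMaximal {P : Ideal R} (hP : P.IsMaximal) {a : R} (ha : a ≠ 0) :
    FiniteMultiplicity P (Ideal.span {a}) :=
  FiniteMultiplicity.of_prime_left (prime_of_isMaximal hR hP) (by simpa using ha)

theorem idealOrder_mul {s : Set R} (hs : IsMaximalSet s) {a c : R} (ha : a ≠ 0) (hc : c ≠ 0) :
    idealOrder s (a * c) = idealOrder s a + idealOrder s c := by
  obtain ⟨P, hP, rfl⟩ := hs
  have h := finiteMultiplicity_of_isMaximal hR hP (mul_ne_zero ha hc)
  rw [← Ideal.span_singleton_mul_span_singleton] at h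
  rw [idealOrder_coe, idealOrder_coe, idealOrder_coe, ← Ideal.span_singleton_mul_span_singleton,
    multiplicity_mul (prime_of_isMaximal hR hP) h]

/-- Only finitely many maximal ideals `P` contain `c`. The Chinese remainder theorem provides `a`
congruent modulo `P ^ (n + 1)` to a chosen element of `P ^ n \ P ^ (n + 1)` for each of them. -/
theorem exists_idealOrder_eq {c : R} (hc : c ≠ 0) (n : Set R → ℕ) :
    ∃ a : R, a ≠ 0 ∧ ∀ s, IsMaximalSet s → c ∈ s → idealOrder s a = n s := by
  classical
  -- If `c` is a unit there is no order to prescribe, and the remainder theorem would not prevent `a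
  -- = 0`.
  by_cases hex : ∃ s : Set R, IsMaximalSet s ∧ c ∈ s
  swap
  · push Not at hex
    exact ⟨1, one_ne_zero, fun s hs hcs => absurd hcs (hex s hs)⟩
  let F := (finite_isMaximalSet_mem hc).toFinset
  have hF : ∀ s, s ∈ F ↔ IsMaximalSet s ∧ c ∈ s := fun s => by simp [F]
  have hspan : ∀ s ∈ F, (Ideal.span s).IsMaximal ∧ (Ideal.span s : Set R) = s := fun s hs => by
    obtain ⟨P, hP, rfl⟩ := ((hF s).1 hs).1
    rw [Ideal.span_eq]
    exact ⟨hP, rfl⟩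
  have hx : ∀ s : F, ∃ x ∈ Ideal.span s.1 ^ n s, x ∉ Ideal.span s.1 ^ (n s + 1) := fun s =>
    Ideal.exists_mem_pow_notMem_pow_succ _ (prime_of_isMaximal hR (hspan s.1 s.2).1).ne_zero
      (hspan s.1 s.2).1.ne_top _
  choose x hx1 hx2 using hx
  obtain ⟨a, ha⟩ := IsDedekindDomain.exists_forall_sub_mem_ideal (s := F)
    (fun s => Ideal.span s) (fun s => n s + 1) (fun s hs => prime_of_isMaximal hR (hspan s hs).1)
    (fun s hs t ht hst h => hst (by rw [← (hspan s hs).2, ← (hspan t ht).2, h])) x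
  have key : ∀ s ∈ F, a ∈ Ideal.span s ^ n s ∧ a ∉ Ideal.span s ^ (n s + 1) := fun s hs => by
    refine ⟨?_, fun h => hx2 ⟨s, hs⟩ ?_⟩
    · have := Ideal.add_mem _ (Ideal.pow_le_pow_right (Nat.le_succ _) (ha s hs)) (hx1 ⟨s, hs⟩)
      simpa using this
    · have := Ideal.sub_mem _ h (ha s hs)
      simpa using this
  refine ⟨a, ?_, fun s hs hcs => ?_⟩
  · rintro rfl
    obtain ⟨s, hs⟩ := hex
    exact (key s ((hF s).2 hs)).2 (Ideal.zero_mem _)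
  · obtain ⟨h1, h2⟩ := key s ((hF s).2 ⟨hs, hcs⟩)
    exact multiplicity_eq_of_dvd_of_not_dvd (Ideal.dvd_span_singleton.2 h1)
      (fun h => h2 (Ideal.dvd_span_singleton.1 h))

/-- Every ideal of a Dedekind domain is generated by any of its nonzero elements and one more. The
two elements cut out the single point `s` of the maximal spectrum. -/
theorem exists_two_generators {s : Set R} (hs : IsMaximalSet s) :
    ∃ c : R × R, c.1 ≠ 0 ∧ c.1 ∈ s ∧ c.2 ∈ s ∧
      ∀ t, IsMaximalSet t → c.1 ∈ t → c.2 ∈ t → s = t := by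
  obtain ⟨P, hP, rfl⟩ := hs
  obtain ⟨a, haP, ha⟩ := Submodule.exists_mem_ne_zero_of_ne_bot
    (Ring.ne_bot_of_isMaximal_of_not_isField hP hR)
  obtain ⟨x, hx⟩ := IsDedekindDomain.exists_sup_span_eq
    ((Ideal.span_singleton_le_iff_mem P).2 haP) (by simpa using ha)
  refine ⟨(a, x), ha, haP, ?_, ?_⟩
  · have : x ∈ P := hx ▸ Ideal.mem_sup_right (Ideal.mem_span_singleton_self x)
    exact this
  · rintro _ ⟨Q, hQ, rfl⟩ haQ hxQ
    rw [hP.eq_of_le hQ.ne_top]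
    rw [← hx, sup_le_iff, Ideal.span_singleton_le_iff_mem, Ideal.span_singleton_le_iff_mem]
    exact ⟨haQ, hxQ⟩

/-- Additivity turns the equation into `ord e = ord a + ord d`, because `t` has order `0` at `s`;
and `ord d > 0`. -/
theorem not_idealOrder_le {s : Set R} (hs : IsMaximalSet s) {a e d t : R} (ha : a ≠ 0)
    (he : e ≠ 0) (ht : t ∉ s) (hd : d ∈ s) (h : t * e = a * d) :
    ¬ idealOrder s e ≤ idealOrder s a := by
  have ht0 : t ≠ 0 := by
    rintro rfl
    obtain ⟨P, hP, rfl⟩ := hs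
    exact ht P.zero_mem
  have hd0 : d ≠ 0 := by
    rintro rfl
    rw [mul_zero] at h
    exact mul_ne_zero ht0 he h
  have := congrArg (idealOrder s) h
  rw [idealOrder_mul hR hs ht0 he, idealOrder_mul hR hs ha hd0, idealOrder_eq_zero hs ht] at this
  have := idealOrder_pos hs hd
  omega

theorem idealOrder_le {s : Set R} (hs : IsMaximalSet s) {a e d t : R} (ha : a ≠ 0)
    (he : e ≠ 0) (ht : t ∉ s) (h : t * e = a * d) :
    idealOrder s a ≤ idealOrder s e := by
  have ht0 : t ≠ 0 := by
    rintro rfl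
    obtain ⟨P, hP, rfl⟩ := hs
    exact ht P.zero_mem
  have hd0 : d ≠ 0 := by
    rintro rfl
    rw [mul_zero] at h
    exact mul_ne_zero ht0 he h
  have := congrArg (idealOrder s) h
  rw [idealOrder_mul hR hs ht0 he, idealOrder_mul hR hs ha hd0, idealOrder_eq_zero hs ht] at this
  omega

end Dedekind

/-! ### Łoś's theorem for internal elements -/

namespace NonstandardExtension

variable {S : NonstandardExtension.{u, v}}

/-- The ultrafilter of the sets whose extension contains `x`. -/
def germ {X : Type u} (x : S.obj X) : Ultrafilter X :=
  Ultrafilter.ofComplNotMemIff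
    { sets := {s | x ∈ S.ext s}
      univ_sets := by
        change x ∈ S.ext _
        rw [ext_univ]
        trivial
      sets_of_superset := fun hs hst => ext_mono hst hs
      inter_sets := fun {s t} hs ht => by
        change x ∈ S.ext _
        rw [ext_inter]
        exact ⟨hs, ht⟩ }
    fun s => by
      change ¬ x ∈ S.ext sᶜ ↔ x ∈ S.ext s
      rw [ext_compl, Set.notMem_compl_iff]

theorem eventually_germ {X : Type u} {x : S.obj X} {P : X → Prop} :
    (∀ᶠ a in germ x, P a) ↔ x ∈ S.ext {a | P a} := Iff.rfl

theorem eventually_germ_map {X Y : Type u} {f : X → Y} {x : S.obj X} {P : Y → Prop} :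
    (∀ᶠ a in germ (S.map f x), P a) ↔ ∀ᶠ a in germ x, P (f a) := by
  rw [eventually_germ, eventually_germ]
  change S.map f x ∈ _ ↔ x ∈ S.ext (f ⁻¹' {a | P a})
  rw [ext_preimage]
  rfl

theorem map_eq_map_iff_eventually {X Y : Type u} {f g : X → Y} {x : S.obj X} :
    S.map f x = S.map g x ↔ ∀ᶠ a in germ x, f a = g a :=
  S.map_eq_map_iff f g x

theorem map_le_map_iff_eventually {X Y : Type u} [Preorder Y] {f g : X → Y} {x : S.obj X} :
    S.map f x ≤ S.map g x ↔ ∀ᶠ a in germ x, f a ≤ g a := by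
  change S.pair.symm (S.map f x, S.map g x) ∈ S.ext {p : Y × Y | p.1 ≤ p.2} ↔ _
  rw [pair_symm_map]
  exact eventually_germ_map (P := fun p : Y × Y => p.1 ≤ p.2)

theorem map_add_map {X Y : Type u} [AddCommGroup Y] (f g : X → Y) (x : S.obj X) :
    S.map f x + S.map g x = S.map (fun a => f a + g a) x :=
  map₂_map_map _ f g x

instance {X : Type u} [AddCommGroup X] [Preorder X] [IsOrderedAddMonoid X] :
    IsOrderedAddMonoid (S.obj X) where
  add_le_add_left x y h z := by
    obtain ⟨t, ht, rfl⟩ := exists_pair (S := S) x y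
    obtain ⟨w, rfl, rfl⟩ := exists_pair (S := S) t z
    subst ht
    simp only [← S.map_comp] at h ⊢
    rw [map_le_map_iff_eventually] at h
    rw [map_add_map, map_add_map, map_le_map_iff_eventually]
    filter_upwards [h] with a ha
    exact add_le_add_left ha _

namespace Internal

variable {I : Type u} {b : S.obj I} {Y Z W T : I → Type u}

/-- The ultrafilter of the families of subsets to which the internal element `w` belongs. -/
def ultra (w : Internal S T b) : Filter (Σ i, T i) := germ w.1

instance (w : Internal S T b) : w.ultra.NeBot := (germ w.1).neBot

theorem eventually_not {w : Internal S T b} {P : (Σ i, T i) → Prop} :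
    (∀ᶠ q in w.ultra, ¬ P q) ↔ ¬ ∀ᶠ q in w.ultra, P q :=
  Ultrafilter.eventually_not (f := germ w.1)

theorem eventually_imp {w : Internal S T b} {P Q : (Σ i, T i) → Prop} :
    (∀ᶠ q in w.ultra, P q → Q q) ↔ ((∀ᶠ q in w.ultra, P q) → ∀ᶠ q in w.ultra, Q q) :=
  Ultrafilter.eventually_imp (f := germ w.1)

theorem eventually_iff {w : Internal S T b} {P Q : (Σ i, T i) → Prop} :
    (∀ᶠ q in w.ultra, (P q ↔ Q q)) ↔ ((∀ᶠ q in w.ultra, P q) ↔ ∀ᶠ q in w.ultra, Q q) := by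
  simp only [iff_iff_implies_and_implies, Filter.eventually_and, eventually_imp]

theorem eventually_ultra_map {f : ∀ i, T i → Y i} {w : Internal S T b}
    {P : (Σ i, Y i) → Prop} :
    (∀ᶠ q in (map f w).ultra, P q) ↔ ∀ᶠ q in w.ultra, P ⟨q.1, f q.1 q.2⟩ :=
  eventually_germ_map

theorem eventually_of_index {P : I → Prop} (h : b ∈ S.ext {i | P i}) (w : Internal S T b) :
    ∀ᶠ q in w.ultra, P q.1 := by
  have h' : ∀ᶠ i in germ b, P i := h
  rw [← w.2] at h'
  exact eventually_germ_map.1 h'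

theorem map_eq_map_iff {f g : ∀ i, T i → Y i} {w : Internal S T b} :
    map f w = map g w ↔ ∀ᶠ q in w.ultra, f q.1 q.2 = g q.1 q.2 := by
  refine Subtype.ext_iff.trans ?_
  change S.map _ _ = S.map _ _ ↔ _
  rw [map_eq_map_iff_eventually]
  refine Filter.eventually_congr (.of_forall fun q => ?_)
  simp

theorem rel_map_map_iff {R : ∀ i, Y i → Z i → Prop} {g : ∀ i, T i → Y i} {h : ∀ i, T i → Z i}
    {w : Internal S T b} :
    Rel R (map g w) (map h w) ↔ ∀ᶠ q in w.ultra, R q.1 (g q.1 q.2) (h q.1 q.2) := by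
  rw [rel_map_map]
  rfl

/-- The existential step of Łoś's theorem: witnesses are chosen for every parameter value (an
arbitrary one where none exists), so that `map g w` is an internal witness. -/
theorem exists_of_eventually [∀ i, Nonempty (Y i)] {w : Internal S T b}
    {R : ∀ i, T i → Y i → Prop} (h : ∀ᶠ q in w.ultra, ∃ y, R q.1 q.2 y) :
    ∃ g : ∀ i, T i → Y i, ∀ᶠ q in w.ultra, R q.1 q.2 (g q.1 q.2) := by
  refine ⟨fun i t => Classical.epsilon (R i t), ?_⟩
  filter_upwards [h] with q hq
  exact Classical.epsilon_spec hq

/-- The universal step: the quantifier runs over all internal `u` that extend the parameter `w` by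
one coordinate. A choice of counterexamples would be such an extension. -/
theorem eventually_forall_iff [∀ i, Nonempty (Y i)] {w : Internal S T b}
    {R : ∀ i, T i → Y i → Prop} : (∀ᶠ q in w.ultra, ∀ y, R q.1 q.2 y) ↔
      ∀ u : Internal S (fun i => T i × Y i) b, map (fun _ p => p.1) u = w →
        ∀ᶠ q in u.ultra, R q.1 q.2.1 q.2.2 := by
  constructor
  · rintro h u rfl
    have := eventually_ultra_map.1 h
    filter_upwards [this] with q hq
    exact hq _
  · intro h
    by_contra hn
    rw [← Internal.eventually_not] at hn
    simp only [not_forall] at hn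
    obtain ⟨g, hg⟩ := exists_of_eventually (R := fun i t y => ¬ R i t y) hn
    have := h (map (fun i t => (t, g i t)) w) (by rw [map_map, map_id])
    have := eventually_ultra_map.1 this
    obtain ⟨q, h1, h2⟩ := (this.and hg).exists
    exact h2 h1

section Ring

variable {A : I → Type u} [∀ i, CommRing (A i)]

theorem map_add_map (f g : ∀ i, T i → A i) (w : Internal S T b) :
    map f w + map g w = map (fun i a => f i a + g i a) w := map₂_map_map _ f g w

theorem map_mul_map (f g : ∀ i, T i → A i) (w : Internal S T b) :
    map f w * map g w = map (fun i a => f i a * g i a) w := map₂_map_map _ f g w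

theorem neg_map (f : ∀ i, T i → A i) (w : Internal S T b) :
    - map f w = map (fun i a => - f i a) w := map_map _ f w

theorem map_sub_map (f g : ∀ i, T i → A i) (w : Internal S T b) :
    map f w - map g w = map (fun i a => f i a - g i a) w := by
  simp only [sub_eq_add_neg, neg_map, map_add_map]

theorem zero_eq_map (w : Internal S T b) : (0 : Internal S A b) = map (fun _ _ => 0) w :=
  (map_const_fun _ w).symm

theorem one_eq_map (w : Internal S T b) : (1 : Internal S A b) = map (fun _ _ => 1) w :=
  (map_const_fun _ w).symm

theorem map_eq_zero_iff {f : ∀ i, T i → A i} {w : Internal S T b} :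
    map f w = 0 ↔ ∀ᶠ q in w.ultra, f q.1 q.2 = 0 := by
  rw [zero_eq_map w, map_eq_map_iff]

theorem map_ne_zero_iff {f : ∀ i, T i → A i} {w : Internal S T b} :
    map f w ≠ 0 ↔ ∀ᶠ q in w.ultra, f q.1 q.2 ≠ 0 := by
  rw [Ne, map_eq_zero_iff, ← Internal.eventually_not]

theorem map_eq_one_iff {f : ∀ i, T i → A i} {w : Internal S T b} :
    map f w = 1 ↔ ∀ᶠ q in w.ultra, f q.1 q.2 = 1 := by
  rw [one_eq_map w, map_eq_map_iff]

theorem map_dvd_map {f g : ∀ i, T i → A i} {w : Internal S T b}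
    (h : ∀ᶠ q in w.ultra, f q.1 q.2 ∣ g q.1 q.2) : map f w ∣ map g w := by
  obtain ⟨c, hc⟩ := exists_of_eventually (R := fun i t c => g i t = f i t * c) h
  refine ⟨map c w, ?_⟩
  rw [map_mul_map, map_eq_map_iff]
  exact hc

end Ring

theorem toStar_map {X : Type u} (f : ∀ i, T i → X) (w : Internal S T b) :
    toStar (map f w) = S.map (fun q => f q.1 q.2) w.1 :=
  (S.map_comp _ _ _).symm

theorem toStar_map_le {X : Type u} [Preorder X] {f g : ∀ i, T i → X} {w : Internal S T b} :
    toStar (map f w) ≤ toStar (map g w) ↔ ∀ᶠ q in w.ultra, f q.1 q.2 ≤ g q.1 q.2 := by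
  rw [toStar_map, toStar_map, map_le_map_iff_eventually]
  rfl

theorem toStar_map_eq {X : Type u} {f g : ∀ i, T i → X} {w : Internal S T b} :
    toStar (map f w) = toStar (map g w) ↔ ∀ᶠ q in w.ultra, f q.1 q.2 = g q.1 q.2 := by
  rw [toStar_map, toStar_map, map_eq_map_iff_eventually]
  rfl

theorem toStar_map_add {X : Type u} [AddCommGroup X] (f g : ∀ i, T i → X) (w : Internal S T b) :
    toStar (map f w) + toStar (map g w) = toStar (map (fun i t => f i t + g i t) w) := by
  rw [toStar_map, toStar_map, toStar_map]
  exact NonstandardExtension.map_add_map _ _ _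

theorem toStar_map_eq_zero {X : Type u} [AddCommGroup X] {f : ∀ i, T i → X}
    {w : Internal S T b} : toStar (map f w) = 0 ↔ ∀ᶠ q in w.ultra, f q.1 q.2 = 0 := by
  rw [toStar_map, obj_zero_def, ← NonstandardExtension.map_const_fun 0 w.1,
    map_eq_map_iff_eventually]
  rfl

/-- The pair `(b, z)` is an element over `b` of the constant family. -/
theorem exists_toStar_eq {X : Type u} (z : S.obj X) :
    ∃ y : Internal S (fun _ : I => X) b, y.toStar = z := by
  obtain ⟨w, rfl, rfl⟩ := NonstandardExtension.exists_pair b z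
  refine ⟨⟨S.map (fun p => ⟨p.1, p.2⟩) w, ?_⟩, ?_⟩
  · rw [← S.map_comp]
    rfl
  · change S.map _ (S.map _ _) = _
    rw [← S.map_comp]
    rfl

end Internal

/-! ### Internal subsets and transfer of maximality -/

section Codes

open Internal

variable {I : Type u} {A : I → Type u} [∀ i, CommRing (A i)] {b : S.obj I} {T : I → Type u}

-- The code is presented as `map s w` with the same `w` as the element, so that one ultrafilter
-- carries all parameters of a statement.
omit [∀ i, CommRing (A i)] in
theorem Codes.map_mem_iff {w : S.Internal T b} {s : ∀ i, T i → Set (A i)}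
    {c : S.Internal (fun i => Set (A i)) b} {U : Set (S.Internal A b)} (hU : Codes c U)
    (hs : Internal.map s w = c) {f : ∀ i, T i → A i} :
    Internal.map f w ∈ U ↔ ∀ᶠ q in w.ultra, f q.1 q.2 ∈ s q.1 q.2 := by
  subst hs
  rw [hU, rel_map_map_iff]

omit [∀ i, CommRing (A i)] in
theorem codes_setOf (c : S.Internal (fun i => Set (A i)) b) :
    Codes c {x | Internal.Rel (fun _ x s => x ∈ s) x c} := fun _ => Iff.rfl

/-- Transfer of set extensionality. An internal set therefore has only one code, and quantifiers
over codes can be dropped. -/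
theorem Codes.eq {c d : S.Internal (fun i => Set (A i)) b} {U : Set (S.Internal A b)}
    (hc : Codes c U) (hd : Codes d U) : c = d := by
  obtain ⟨w, rfl, rfl⟩ := Internal.exists_pair c d
  rw [Internal.map_eq_map_iff]
  simp only [Set.ext_iff]
  rw [eventually_forall_iff (Y := A) (R := fun i (p : Set (A i) × Set (A i)) x => x ∈ p.1 ↔ x ∈ p.2)]
  rintro u rfl
  rw [Internal.map_map] at hc hd
  have h1 := hc.map_mem_iff rfl (f := fun _ p => p.2)
  have h2 := hd.map_mem_iff rfl (f := fun _ p => p.2)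
  exact Internal.eventually_iff.2 (h1.symm.trans h2)

/-- The elementwise criterion is transferred clause by clause. So an internal set that is a maximal
ideal at almost all indices is genuinely maximal in `B`, among external ideals too. -/
theorem isMaximalSet_iff_eventually {c : S.Internal (fun i => Set (A i)) b}
    {U : Set (S.Internal A b)} (hc : Codes c U) :
    IsMaximalSet U ↔ ∀ᶠ q in c.ultra, IsMaximalSet q.2 := by
  simp only [isMaximalSet_iff, Filter.eventually_and]
  refine and_congr ?_ (and_congr ?_ (and_congr ?_ (and_congr ?_ ?_)))
  · rw [zero_eq_map c, hc.map_mem_iff (Internal.map_id c)]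
  · rw [eventually_forall_iff (Y := fun i => A i × A i)
      (R := fun _ s x => x.1 ∈ s → x.2 ∈ s → x.1 + x.2 ∈ s)]
    have key : ∀ u : S.Internal (fun i => Set (A i) × A i × A i) b,
        Internal.map (fun _ p => p.1) u = c →
        ((∀ᶠ q in u.ultra, q.2.2.1 ∈ q.2.1 → q.2.2.2 ∈ q.2.1 → q.2.2.1 + q.2.2.2 ∈ q.2.1) ↔
        (Internal.map (fun _ p => p.2.1) u ∈ U → Internal.map (fun _ p => p.2.2) u ∈ U →
          Internal.map (fun _ p => p.2.1) u + Internal.map (fun _ p => p.2.2) u ∈ U)) := by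
      intro u hu
      rw [Internal.map_add_map, hc.map_mem_iff hu, hc.map_mem_iff hu, hc.map_mem_iff hu,
        eventually_imp, Internal.eventually_imp]
    constructor
    · exact fun h u hu => (key u hu).2 (h (_, _))
    · rintro h ⟨x, y⟩
      obtain ⟨t, rfl, rfl⟩ := Internal.exists_pair x y
      obtain ⟨u, hu, rfl⟩ := Internal.exists_pair c t
      have := (key u hu).1 (h u hu)
      rwa [Internal.map_map, Internal.map_map]
  · rw [eventually_forall_iff (Y := fun i => A i × A i)
      (R := fun _ s x => x.2 ∈ s → x.1 * x.2 ∈ s)]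
    have key : ∀ u : S.Internal (fun i => Set (A i) × A i × A i) b,
        Internal.map (fun _ p => p.1) u = c →
        ((∀ᶠ q in u.ultra, q.2.2.2 ∈ q.2.1 → q.2.2.1 * q.2.2.2 ∈ q.2.1) ↔
        (Internal.map (fun _ p => p.2.2) u ∈ U →
          Internal.map (fun _ p => p.2.1) u * Internal.map (fun _ p => p.2.2) u ∈ U)) := by
      intro u hu
      rw [Internal.map_mul_map, hc.map_mem_iff hu, hc.map_mem_iff hu,
        Internal.eventually_imp]
    constructor
    · exact fun h u hu => (key u hu).2 (h (_, _))
    · rintro h ⟨x, y⟩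
      obtain ⟨t, rfl, rfl⟩ := Internal.exists_pair x y
      obtain ⟨u, hu, rfl⟩ := Internal.exists_pair c t
      have := (key u hu).1 (h u hu)
      rwa [Internal.map_map, Internal.map_map]
  · rw [one_eq_map c, hc.map_mem_iff (Internal.map_id c), Internal.eventually_not]
  · rw [eventually_forall_iff (Y := A) (R := fun _ s x => x ∉ s → ∃ y, 1 - x * y ∈ s)]
    constructor
    · intro h u hu
      rw [eventually_imp, Internal.eventually_not]
      intro hx
      obtain ⟨y, hy⟩ := h (Internal.map (fun _ p => p.2) u) (by rwa [hc.map_mem_iff hu])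
      obtain ⟨t, ht, rfl⟩ := Internal.exists_pair u y
      rw [one_eq_map t] at hy
      subst ht
      rw [Internal.map_map, map_mul_map, map_sub_map,
        hc.map_mem_iff ((Internal.map_map _ _ t).symm.trans hu)] at hy
      refine eventually_ultra_map.2 ?_
      filter_upwards [hy] with q hq
      exact ⟨_, hq⟩
    · intro h x hx
      obtain ⟨u, hu, rfl⟩ := Internal.exists_pair c x
      have h1 := h u hu
      rw [hc.map_mem_iff hu, ← Internal.eventually_not] at hx
      obtain ⟨g, hg⟩ := exists_of_eventually (Y := A) (R := fun i (p : Set (A i) × A i) y => 1 - p.2 * y ∈ p.1)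
        ((Internal.eventually_imp.1 h1) hx)
      refine ⟨Internal.map g u, ?_⟩
      rwa [one_eq_map u, map_mul_map, map_sub_map, hc.map_mem_iff hu]

end Codes

end NonstandardExtension

namespace NonstandardExtension

variable {S : NonstandardExtension.{u, v}}

/-! ### Codes of internal maximal ideals, orders at them, hyperfinite sets -/

section InternalMaximal

open Internal

variable {I : Type u} {A : I → Type u} [∀ i, CommRing (A i)] {b : S.obj I} {T : I → Type u}

namespace InternalMaximal

/-- The code of an internal maximal ideal. -/
noncomputable def code (p : S.InternalMaximal A b) : S.Internal (fun i => Set (A i)) b :=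
  p.2.2.choose

theorem codes_code (p : S.InternalMaximal A b) : Codes p.code (p.1 : Set (S.Internal A b)) :=
  p.2.2.choose_spec

theorem map_mem_iff (p : S.InternalMaximal A b) {w : S.Internal T b} {s : ∀ i, T i → Set (A i)}
    (hs : Internal.map s w = p.code) {f : ∀ i, T i → A i} :
    Internal.map f w ∈ p.1 ↔ ∀ᶠ q in w.ultra, f q.1 q.2 ∈ s q.1 q.2 :=
  p.codes_code.map_mem_iff hs

theorem map_notMem_iff (p : S.InternalMaximal A b) {w : S.Internal T b}
    {s : ∀ i, T i → Set (A i)} (hs : Internal.map s w = p.code) {f : ∀ i, T i → A i} :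
    Internal.map f w ∉ p.1 ↔ ∀ᶠ q in w.ultra, f q.1 q.2 ∉ s q.1 q.2 := by
  rw [p.map_mem_iff hs, Internal.eventually_not]

theorem eventually_isMaximalSet (p : S.InternalMaximal A b) {w : S.Internal T b}
    {s : ∀ i, T i → Set (A i)} (hs : Internal.map s w = p.code) :
    ∀ᶠ q in w.ultra, IsMaximalSet (s q.1 q.2) := by
  have h := (isMaximalSet_iff_eventually p.codes_code).1 ⟨p.1, p.2.1, rfl⟩
  rw [← hs] at h
  exact eventually_ultra_map.1 h

theorem exists_code_eq {c : S.Internal (fun i => Set (A i)) b}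
    (hc : ∀ᶠ q in c.ultra, IsMaximalSet q.2) : ∃ p : S.InternalMaximal A b, p.code = c := by
  obtain ⟨P, hP, hPc⟩ := (isMaximalSet_iff_eventually (codes_setOf c)).2 hc
  have hc' : Codes c (P : Set (S.Internal A b)) := hPc ▸ codes_setOf c
  let p : S.InternalMaximal A b := ⟨P, hP, c, hc'⟩
  exact ⟨p, p.codes_code.eq hc'⟩

theorem code_injective : Function.Injective (code : S.InternalMaximal A b → _) := by
  intro p p' h
  refine Subtype.ext (Ideal.ext fun x => ?_)
  have h1 := p.codes_code x
  have h2 := p'.codes_code x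
  rw [h] at h1
  exact h1.trans h2.symm

/-- The order of vanishing of `a` at `p`. -/
noncomputable def order (p : S.InternalMaximal A b) (a : S.Internal A b) : S.HyperInt :=
  (Internal.map₂ (fun _ a s => ULift.up (idealOrder s a : ℤ)) a p.code).toStar

theorem order_map (p : S.InternalMaximal A b) {w : S.Internal T b}
    {s : ∀ i, T i → Set (A i)} (hs : Internal.map s w = p.code) (f : ∀ i, T i → A i) :
    p.order (Internal.map f w) =
      (Internal.map (fun i t => ULift.up (idealOrder (s i t) (f i t) : ℤ)) w).toStar := by
  rw [order, ← hs, Internal.map₂_map_map]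

end InternalMaximal

theorem isHyperfinite_iff {H : Set (S.InternalMaximal A b)} : IsHyperfinite H ↔
    ∃ h : S.Internal (fun i => Finset (Set (A i))) b,
      ∀ p, p ∈ H ↔ Internal.Rel (fun _ s t => s ∈ t) p.code h := by
  refine exists_congr fun h => forall_congr' fun p => iff_congr Iff.rfl ?_
  constructor
  · rintro ⟨c, hc, hR⟩
    rwa [p.codes_code.eq hc]
  · exact fun hR => ⟨p.code, p.codes_code, hR⟩

theorem IsHyperfinite.inter {H K : Set (S.InternalMaximal A b)} (hH : IsHyperfinite H)
    (hK : IsHyperfinite K) : IsHyperfinite (H ∩ K) := by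
  classical
  rw [isHyperfinite_iff] at hH hK ⊢
  obtain ⟨h, hh⟩ := hH
  obtain ⟨k, hk⟩ := hK
  refine ⟨Internal.map₂ (fun _ s t => s ∩ t) h k, fun p => ?_⟩
  rw [Set.mem_inter_iff, hh, hk]
  obtain ⟨t, rfl, rfl⟩ := Internal.exists_pair h k
  obtain ⟨w, rfl, hw⟩ := Internal.exists_pair t p.code
  rw [← hw]
  simp only [Internal.map_map, Internal.map₂_map_map, rel_map_map_iff, Finset.mem_inter,
    Filter.eventually_and]

theorem isInternalFun_iff {f : S.InternalMaximal A b → S.HyperInt} : IsInternalFun f ↔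
    ∃ φ : S.Internal (fun i => Set (A i) → ULift.{u} ℤ) b,
      ∀ p, f p = (Internal.map₂ (fun _ ψ s => ψ s) φ p.code).toStar := by
  refine exists_congr fun φ => forall_congr' fun p => ?_
  exact ⟨fun h => h _ p.codes_code, fun h c hc => by rw [h, p.codes_code.eq hc]⟩

end InternalMaximal

/-! ### Transfer of the Dedekind facts to `B` -/

section Dedekind

open Internal

variable {I : Type u} {A : I → Type u} [∀ i, CommRing (A i)] {b : S.obj I} {T : I → Type u}

theorem IsInternalDedekind.eventually (hB : S.IsInternalDedekind A b) (w : S.Internal T b) :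
    ∀ᶠ q in w.ultra, IsDedekindDomain (A q.1) ∧ ¬ IsField (A q.1) :=
  eventually_of_index hB w

theorem IsInternalDedekind.isDomain (hB : S.IsInternalDedekind A b) :
    IsDomain (S.Internal A b) := by
  have h0 : Nontrivial (S.Internal A b) := by
    refine ⟨1, 0, ?_⟩
    let w : S.Internal (fun _ => PUnit) b := Internal.const fun _ => PUnit.unit
    rw [one_eq_map w, Internal.map_ne_zero_iff]
    filter_upwards [hB.eventually w] with q ⟨_, _⟩
    exact one_ne_zero
  have h1 : NoZeroDivisors (S.Internal A b) := by
    refine ⟨fun {x y} hxy => ?_⟩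
    obtain ⟨w, rfl, rfl⟩ := Internal.exists_pair x y
    by_contra! hne
    rw [Internal.map_ne_zero_iff, Internal.map_ne_zero_iff] at hne
    rw [map_mul_map, Internal.map_eq_zero_iff] at hxy
    obtain ⟨q, ⟨⟨_, _⟩, h1⟩, h2, h3⟩ := (((hB.eventually w).and hxy).and (hne.1.and hne.2)).exists
    exact mul_ne_zero h2 h3 h1
  exact NoZeroDivisors.to_isDomain _

theorem IsInternalDedekind.exists_add_eq_one_and_dvd_mul (hB : S.IsInternalDedekind A b)
    (x y : S.Internal A b) : ∃ s t, s + t = 1 ∧ y ∣ s * x ∧ x ∣ t * y := by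
  obtain ⟨w, rfl, rfl⟩ := Internal.exists_pair x y
  obtain ⟨g, hg⟩ := exists_of_eventually (Y := fun i => A i × A i) (w := w)
    (R := fun i p c => c.1 + c.2 = 1 ∧ p.2 ∣ c.1 * p.1 ∧ p.1 ∣ c.2 * p.2) (by
      filter_upwards [hB.eventually w] with q ⟨_, _⟩
      exact _root_.exists_add_eq_one_and_dvd_mul _ _)
  simp only [Filter.eventually_and] at hg
  refine ⟨Internal.map (fun i t => (g i t).1) w, Internal.map (fun i t => (g i t).2) w, ?_, ?_, ?_⟩
  · rw [Internal.map_add_map, Internal.map_eq_one_iff]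
    exact hg.1
  · rw [map_mul_map]
    exact map_dvd_map hg.2.1
  · rw [map_mul_map]
    exact map_dvd_map hg.2.2

/-- Nonzero nonunits of the `A i` assemble to a nonzero nonunit of `B`, whereas `B` would be a field
if `⊥` were maximal. -/
theorem IsInternalDedekind.ne_bot (hB : S.IsInternalDedekind A b)
    (m : Ideal (S.Internal A b)) [hm : m.IsMaximal] : m ≠ ⊥ := by
  rintro rfl
  let w : S.Internal (fun _ => PUnit) b := Internal.const fun _ => PUnit.unit
  obtain ⟨g, hg⟩ := exists_of_eventually (Y := A) (w := w)
    (R := fun _ _ a => a ≠ 0 ∧ ∀ c, a * c ≠ 1) (by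
      filter_upwards [hB.eventually w] with q ⟨_, h⟩
      exact exists_ne_zero_forall_ne_one h)
  simp only [Filter.eventually_and] at hg
  obtain ⟨y, i, hi, h⟩ := hm.exists_inv (x := Internal.map g w)
    (by rw [Ideal.mem_bot]; exact Internal.map_ne_zero_iff.2 hg.1)
  rw [Ideal.mem_bot] at hi
  obtain ⟨t, ht, rfl⟩ := Internal.exists_pair w y
  rw [hi, add_zero, ← ht, Internal.map_map, map_mul_map, Internal.map_eq_one_iff] at h
  rw [← ht] at hg
  obtain ⟨q, h1, h2⟩ := (h.and (eventually_ultra_map.1 hg.2)).exists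
  exact h2 q.2.2 (by rw [mul_comm]; exact h1)

theorem IsInternalDedekind.isHyperfinite_zeroLocus (hB : S.IsInternalDedekind A b)
    {a : S.Internal A b} (ha : a ≠ 0) : IsHyperfinite (zeroLocus a) := by
  classical
  rw [isHyperfinite_iff]
  -- The code is the finite set of maximal ideals containing `a`; the default `∅` only occurs at
  -- negligible indices.
  refine ⟨Internal.map (fun i a => if h : {s : Set (A i) | IsMaximalSet s ∧ a ∈ s}.Finite
    then h.toFinset else ∅) a, fun p => ?_⟩
  obtain ⟨w, rfl, hw⟩ := Internal.exists_pair a p.code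
  change _ ∈ p.1 ↔ _
  rw [p.map_mem_iff hw, ← hw, Internal.map_map, rel_map_map_iff, ← Internal.eventually_iff]
  rw [Internal.map_ne_zero_iff] at ha
  filter_upwards [hB.eventually w, ha, p.eventually_isMaximalSet hw] with q ⟨_, _⟩ h1 h2
  rw [dif_pos (finite_isMaximalSet_mem h1)]
  simp [h2]

theorem IsInternalDedekind.exists_separation (hB : S.IsInternalDedekind A b)
    {a : S.Internal A b} (ha : a ≠ 0) {H : Set (S.InternalMaximal A b)} (hH : IsHyperfinite H) :
    ∃ e f, e + f = 1 ∧ a ∣ e * f ∧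
      ∀ p ∈ zeroLocus a, (p ∈ H → e ∈ p.1) ∧ (p ∉ H → f ∈ p.1) := by
  obtain ⟨h, hh⟩ := isHyperfinite_iff.1 hH
  obtain ⟨w, rfl, rfl⟩ := Internal.exists_pair a h
  rw [Internal.map_ne_zero_iff] at ha
  obtain ⟨g, hg⟩ := exists_of_eventually (Y := fun i => A i × A i) (w := w)
    (R := fun i p c => c.1 + c.2 = 1 ∧ p.1 ∣ c.1 * c.2 ∧
      ∀ s, IsMaximalSet s → p.1 ∈ s → (s ∈ p.2 → c.1 ∈ s) ∧ (s ∉ p.2 → c.2 ∈ s)) (by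
      filter_upwards [hB.eventually w, ha] with q ⟨_, _⟩ h
      exact _root_.exists_separation h _)
  simp only [Filter.eventually_and] at hg
  refine ⟨Internal.map (fun i t => (g i t).1) w, Internal.map (fun i t => (g i t).2) w,
    ?_, ?_, fun p hp => ?_⟩
  · rw [Internal.map_add_map, Internal.map_eq_one_iff]
    exact hg.1
  · rw [map_mul_map]
    exact map_dvd_map hg.2.1
  · obtain ⟨t, rfl, ht⟩ := Internal.exists_pair w p.code
    replace hg := eventually_ultra_map.1 hg.2.2
    change _ ∈ p.1 at hp
    rw [Internal.map_map, p.map_mem_iff ht] at hp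
    rw [hh p, ← ht]
    simp only [Internal.map_map, p.map_mem_iff ht, rel_map_map_iff, ← Internal.eventually_not]
    rw [← Internal.eventually_imp, ← Internal.eventually_imp, ← Filter.eventually_and]
    filter_upwards [hg, hp, p.eventually_isMaximalSet ht] with q h1 h2 h3
    exact h1 _ h3 h2

theorem IsInternalDedekind.exists_add_mul_mem_imp (hB : S.IsInternalDedekind A b)
    {a : S.Internal A b} (ha : a ≠ 0) (x y : S.Internal A b) :
    ∃ c, ∀ p ∈ zeroLocus a, x + c * y ∈ p.1 → x ∈ p.1 ∧ y ∈ p.1 := by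
  obtain ⟨t, rfl, rfl⟩ := Internal.exists_pair x y
  obtain ⟨w, rfl, rfl⟩ := Internal.exists_pair t a
  rw [Internal.map_ne_zero_iff] at ha
  obtain ⟨g, hg⟩ := exists_of_eventually (Y := A) (w := w)
    (R := fun i p c => ∀ s, IsMaximalSet s → p.2 ∈ s → p.1.1 + c * p.1.2 ∈ s →
      p.1.1 ∈ s ∧ p.1.2 ∈ s) (by
      filter_upwards [hB.eventually w, ha] with q ⟨_, _⟩ h
      exact _root_.exists_add_mul_mem_imp h _ _)
  refine ⟨Internal.map g w, fun p hp hxy => ?_⟩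
  obtain ⟨t, rfl, ht⟩ := Internal.exists_pair w p.code
  change _ ∈ p.1 at hp
  simp only [Internal.map_map, Internal.map_add_map, map_mul_map, p.map_mem_iff ht] at hp hxy ⊢
  rw [← Filter.eventually_and]
  filter_upwards [eventually_ultra_map.1 hg, hp, hxy, p.eventually_isMaximalSet ht]
    with q h1 h2 h3 h4
  exact h1 _ h4 h2 h3

/-- If `a` and `x` had no common maximal ideal at almost all indices, the Bézout coefficients found
there would assemble to a relation `c * a + d * x = 1` in `B`. Otherwise the maximal ideals chosen
at the indices form an internal one. -/
theorem exists_internalMaximal_mem {a x : S.Internal A b} (h : ∀ c d, c * a + d * x ≠ 1) :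
    ∃ p : S.InternalMaximal A b, a ∈ p.1 ∧ x ∈ p.1 := by
  obtain ⟨w, rfl, rfl⟩ := Internal.exists_pair a x
  have hw : ∀ᶠ q in w.ultra, ∃ s, IsMaximalSet s ∧ q.2.1 ∈ s ∧ q.2.2 ∈ s := by
    by_contra hn
    rw [← Internal.eventually_not] at hn
    obtain ⟨g, hg⟩ := exists_of_eventually (Y := fun i => A i × A i) (w := w)
      (R := fun i p c => c.1 * p.1 + c.2 * p.2 = 1) (by
        filter_upwards [hn] with q hq
        by_contra! hc
        exact hq (exists_isMaximalSet_mem_of_ne_one hc))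
    refine h (Internal.map (fun i t => (g i t).1) w) (Internal.map (fun i t => (g i t).2) w) ?_
    rwa [map_mul_map, map_mul_map, Internal.map_add_map, Internal.map_eq_one_iff]
  obtain ⟨g, hg⟩ := exists_of_eventually (Y := fun i => Set (A i)) (w := w)
    (R := fun i p s => IsMaximalSet s ∧ p.1 ∈ s ∧ p.2 ∈ s) hw
  simp only [Filter.eventually_and] at hg
  obtain ⟨p, hp⟩ := InternalMaximal.exists_code_eq (A := A) (c := Internal.map g w)
    (eventually_ultra_map.2 hg.1)
  refine ⟨p, ?_⟩
  rw [p.map_mem_iff hp.symm, p.map_mem_iff hp.symm]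
  exact hg.2

theorem IsInternalDedekind.exists_two_generators (hB : S.IsInternalDedekind A b)
    (p : S.InternalMaximal A b) : ∃ a x, a ≠ 0 ∧ a ∈ p.1 ∧ x ∈ p.1 ∧
      ∀ p' : S.InternalMaximal A b, a ∈ p'.1 → x ∈ p'.1 → p = p' := by
  obtain ⟨g, hg⟩ := exists_of_eventually (Y := fun i => A i × A i) (w := p.code)
    (R := fun i s c => c.1 ≠ 0 ∧ c.1 ∈ s ∧ c.2 ∈ s ∧
      ∀ t, IsMaximalSet t → c.1 ∈ t → c.2 ∈ t → s = t) (by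
      filter_upwards [hB.eventually p.code,
        p.eventually_isMaximalSet (Internal.map_id p.code)] with q ⟨_, hF⟩ h
      exact _root_.exists_two_generators hF h)
  simp only [Filter.eventually_and] at hg
  refine ⟨Internal.map (fun i t => (g i t).1) p.code, Internal.map (fun i t => (g i t).2) p.code,
    Internal.map_ne_zero_iff.2 hg.1, (p.map_mem_iff (Internal.map_id p.code)).2 hg.2.1,
    (p.map_mem_iff (Internal.map_id p.code)).2 hg.2.2.1, fun p' h1 h2 => ?_⟩
  apply InternalMaximal.code_injective
  replace hg := hg.2.2.2
  -- The code becomes a variable so that it can be replaced by a projection of a common parameter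
  -- `t`.
  generalize hc : p.code = c at h1 h2 hg
  clear hc
  obtain ⟨t, rfl, ht⟩ := Internal.exists_pair c p'.code
  rw [← ht, Internal.map_eq_map_iff]
  rw [Internal.map_map, p'.map_mem_iff ht] at h1 h2
  filter_upwards [h1, h2, eventually_ultra_map.1 hg, p'.eventually_isMaximalSet ht]
    with q h3 h4 h5 h6
  exact h5 _ h6 h3 h4

namespace InternalMaximal

theorem order_mul (hB : S.IsInternalDedekind A b) (p : S.InternalMaximal A b)
    {x y : S.Internal A b} (hx : x ≠ 0) (hy : y ≠ 0) :
    p.order (x * y) = p.order x + p.order y := by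
  obtain ⟨t, rfl, rfl⟩ := Internal.exists_pair x y
  obtain ⟨w, rfl, hw⟩ := Internal.exists_pair t p.code
  simp only [Internal.map_map, map_mul_map, Internal.map_ne_zero_iff] at hx hy ⊢
  rw [p.order_map hw, p.order_map hw, p.order_map hw, toStar_map_add, toStar_map_eq]
  filter_upwards [hB.eventually w, hx, hy, p.eventually_isMaximalSet hw] with q ⟨_, hF⟩ h1 h2 h3
  rw [idealOrder_mul hF h3 h1 h2]
  rfl

theorem order_eq_zero (hB : S.IsInternalDedekind A b) (p : S.InternalMaximal A b)
    {x : S.Internal A b} (hx : x ∉ p.1) : p.order x = 0 := by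
  obtain ⟨w, rfl, hw⟩ := Internal.exists_pair x p.code
  rw [p.map_notMem_iff hw] at hx
  rw [p.order_map hw, toStar_map_eq_zero]
  filter_upwards [hB.eventually w, hx, p.eventually_isMaximalSet hw] with q ⟨_, _⟩ h1 h2
  rw [idealOrder_eq_zero h2 h1]
  rfl

theorem order_le (hB : S.IsInternalDedekind A b) (p : S.InternalMaximal A b)
    {a e d t : S.Internal A b} (ha : a ≠ 0) (he : e ≠ 0) (ht : t ∉ p.1) (h : t * e = a * d) :
    p.order a ≤ p.order e := by
  obtain ⟨w, rfl, rfl⟩ := Internal.exists_pair a e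
  obtain ⟨w, rfl, rfl⟩ := Internal.exists_pair w d
  obtain ⟨w, rfl, rfl⟩ := Internal.exists_pair w t
  obtain ⟨w, rfl, hw⟩ := Internal.exists_pair w p.code
  simp only [Internal.map_map, map_mul_map, Internal.map_ne_zero_iff, Internal.map_eq_map_iff,
    p.map_notMem_iff hw] at ha he ht h ⊢
  rw [p.order_map hw, p.order_map hw, toStar_map_le]
  filter_upwards [hB.eventually w, ha, he, ht, h, p.eventually_isMaximalSet hw]
    with q ⟨_, hF⟩ h1 h2 h3 h4 h5
  exact ULift.down_le.1 (Int.ofNat_le.2 (idealOrder_le hF h5 h1 h2 h3 h4))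

theorem not_order_le (hB : S.IsInternalDedekind A b) (p : S.InternalMaximal A b)
    {a e d t : S.Internal A b} (ha : a ≠ 0) (he : e ≠ 0) (ht : t ∉ p.1) (hd : d ∈ p.1)
    (h : t * e = a * d) : ¬ p.order e ≤ p.order a := by
  obtain ⟨w, rfl, rfl⟩ := Internal.exists_pair a e
  obtain ⟨w, rfl, rfl⟩ := Internal.exists_pair w d
  obtain ⟨w, rfl, rfl⟩ := Internal.exists_pair w t
  obtain ⟨w, rfl, hw⟩ := Internal.exists_pair w p.code
  simp only [Internal.map_map, map_mul_map, Internal.map_ne_zero_iff, Internal.map_eq_map_iff,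
    p.map_mem_iff hw, ← Internal.eventually_not] at ha he ht h hd ⊢
  rw [p.order_map hw, p.order_map hw, toStar_map_le, ← Internal.eventually_not]
  filter_upwards [hB.eventually w, ha, he, ht, h, p.eventually_isMaximalSet hw, hd]
    with q ⟨_, hF⟩ h1 h2 h3 h4 h5 h6
  exact fun h7 => not_idealOrder_le hF h5 h1 h2 h3 h6 h4 (Int.ofNat_le.1 h7)

end InternalMaximal

/-- Approximation: an internal function agrees on `V(c)` with the difference of two principal
divisors. -/
theorem IsInternalDedekind.exists_order_eq (hB : S.IsInternalDedekind A b)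
    {c : S.Internal A b} (hc : c ≠ 0) {f : S.InternalMaximal A b → S.HyperInt}
    (hf : IsInternalFun f) : ∃ x y : S.Internal A b, x ≠ 0 ∧ y ≠ 0 ∧
      ∀ p ∈ zeroLocus c, p.order x = f p + p.order y := by
  obtain ⟨φ, hφ⟩ := isInternalFun_iff.1 hf
  obtain ⟨w, rfl, rfl⟩ := Internal.exists_pair c φ
  rw [Internal.map_ne_zero_iff] at hc
  obtain ⟨g, hg⟩ := exists_of_eventually (Y := fun i => A i × A i) (w := w)
    (R := fun i p x => x.1 ≠ 0 ∧ x.2 ≠ 0 ∧ ∀ s, IsMaximalSet s → p.1 ∈ s →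
      ULift.up (idealOrder s x.1 : ℤ) = p.2 s + ULift.up (idealOrder s x.2 : ℤ)) (by
      filter_upwards [hB.eventually w, hc] with q ⟨_, hF⟩ h
      -- Orders are natural numbers, so the integer is split into positive part (order of `x`) and
      -- negative part (order of `y`).
      obtain ⟨x, hx, hx'⟩ := exists_idealOrder_eq hF h fun s => (q.2.2 s).down.toNat
      obtain ⟨y, hy, hy'⟩ := exists_idealOrder_eq hF h fun s => (-(q.2.2 s).down).toNat
      refine ⟨(x, y), hx, hy, fun s hs hsc => ?_⟩
      apply ULift.down_injective
      rw [ULift.add_down, hx' s hs hsc, hy' s hs hsc]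
      change ((q.2.2 s).down.toNat : ℤ) = (q.2.2 s).down + ((-(q.2.2 s).down).toNat : ℤ)
      omega)
  simp only [Filter.eventually_and] at hg
  refine ⟨Internal.map (fun i t => (g i t).1) w, Internal.map (fun i t => (g i t).2) w,
    Internal.map_ne_zero_iff.2 hg.1, Internal.map_ne_zero_iff.2 hg.2.1, fun p hp => ?_⟩
  replace hg := hg.2.2
  obtain ⟨t, rfl, ht⟩ := Internal.exists_pair w p.code
  change _ ∈ p.1 at hp
  rw [Internal.map_map, p.map_mem_iff ht] at hp
  rw [hφ, ← ht]
  simp only [Internal.map_map, Internal.map₂_map_map, p.order_map ht, toStar_map_add, toStar_map_eq]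
  filter_upwards [hp, eventually_ultra_map.1 hg, p.eventually_isMaximalSet ht] with q h1 h2 h3
  exact h2 _ h3 h1

end Dedekind

end NonstandardExtension

/-! ### Recognizing the value group of a valuation ring -/

section ValueGroup

variable {Γ : Type*} [AddCommGroup Γ] [Preorder Γ] [IsOrderedAddMonoid Γ]

/-- A map with the formal properties of the valuation of a valuation ring identifies the value
group. -/
theorem nonempty_addValueGroup_orderAddIso {R L : Type*} [CommRing R] [IsDomain R]
    [ValuationRing R] [Field L] [Algebra R L] [IsFractionRing R L] (ν : R → Γ)
    (hmul : ∀ x y, x ≠ 0 → y ≠ 0 → ν (x * y) = ν x + ν y)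
    (hle : ∀ x y, x ≠ 0 → y ≠ 0 → (ν x ≤ ν y ↔ x ∣ y)) (hunit : ∀ u : Rˣ, ν u = 0)
    (hsurj : ∀ γ, ∃ x y, x ≠ 0 ∧ y ≠ 0 ∧ ν x = γ + ν y) :
    Nonempty (AddValueGroup R L ≃+o Γ) := by
  have hinj := IsFractionRing.injective R L
  have hne : ∀ {x : R}, x ≠ 0 → algebraMap R L x ≠ 0 := fun hx =>
    (map_ne_zero_iff _ hinj).2 hx
  have hdiv : ∀ x : L, ∃ n d : R, d ≠ 0 ∧ algebraMap R L n / algebraMap R L d = x := fun x => by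
    obtain ⟨n, d, hd, h⟩ := IsFractionRing.div_surjective R x
    exact ⟨n, d, nonZeroDivisors.ne_zero hd, h⟩
  choose n d hd hnd using hdiv
  have hn : ∀ {x : L}, x ≠ 0 → n x ≠ 0 := by
    intro x hx h
    have := hnd x
    rw [h, map_zero, zero_div] at this
    exact hx this.symm
  -- The extension of `ν` to fractions; `hD` shows independence of the chosen numerator and
  -- denominator. Its value at `0` is irrelevant.
  let D : L → Γ := fun x => ν (n x) - ν (d x)
  have hD : ∀ {x y : R}, x ≠ 0 → y ≠ 0 → D (algebraMap R L x / algebraMap R L y) = ν x - ν y := by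
    intro x y hx hy
    have h := hnd (algebraMap R L x / algebraMap R L y)
    rw [div_eq_div_iff (hne (hd _)) (hne hy), ← map_mul, ← map_mul] at h
    have h1 := congrArg ν (hinj h)
    rw [hmul _ _ (hn (div_ne_zero (hne hx) (hne hy))) hy, hmul _ _ hx (hd _)] at h1
    exact sub_eq_sub_iff_add_eq_add.2 h1
  have hDmul : ∀ {x y : L}, x ≠ 0 → y ≠ 0 → D (x * y) = D x + D y := by
    intro x y hx hy
    have h : x * y = algebraMap R L (n x * n y) / algebraMap R L (d x * d y) := by
      rw [map_mul, map_mul, mul_div_mul_comm, hnd, hnd]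
    rw [h, hD (mul_ne_zero (hn hx) (hn hy)) (mul_ne_zero (hd x) (hd y)),
      hmul _ _ (hn hx) (hn hy), hmul _ _ (hd x) (hd y)]
    exact (sub_add_sub_comm _ _ _ _).symm
  have hDle : ∀ {x y : L}, x ≠ 0 → y ≠ 0 → (D x ≤ D y ↔ ∃ c : R, c • x = y) := by
    intro x y hx hy
    have h1 : D x ≤ D y ↔ ν (n x * d y) ≤ ν (n y * d x) := by
      rw [hmul _ _ (hn hx) (hd y), hmul _ _ (hn hy) (hd x)]
      exact sub_le_sub_iff
    rw [h1, hle _ _ (mul_ne_zero (hn hx) (hd y)) (mul_ne_zero (hn hy) (hd x))]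
    refine exists_congr fun c => ?_
    rw [Algebra.smul_def]
    nth_rw 3 [← hnd x]
    nth_rw 3 [← hnd y]
    rw [mul_div_assoc', div_eq_div_iff (hne (hd x)) (hne (hd y)), ← map_mul, ← map_mul, ← map_mul,
      hinj.eq_iff, eq_comm, mul_comm (n x * d y) c, mul_assoc]
  have hDunit : ∀ (u : Rˣ) {x : L}, x ≠ 0 → D (u • x) = D x := by
    intro u x hx
    have h : u • x = algebraMap R L u / algebraMap R L 1 * x := by
      rw [map_one, div_one, Units.smul_def, Algebra.smul_def]
    rw [h, hDmul (div_ne_zero (hne u.ne_zero) (hne one_ne_zero)) hx, hD u.ne_zero one_ne_zero,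
      hunit, ← Units.val_one, hunit, sub_zero, zero_add]
  have hrep : ∀ g : (ValuationRing.ValueGroup R L)ˣ,
      ∃ x : L, x ≠ 0 ∧ ValuationRing.valuation R L x = g := by
    intro g
    obtain ⟨x, hx⟩ := Quotient.mk''_surjective g.1
    refine ⟨x, ?_, hx⟩
    rintro rfl
    exact g.ne_zero hx.symm
  choose r hr0 hr using hrep
  let E : AddValueGroup R L → Γ := fun g => D (r (Additive.toMul (OrderDual.ofDual g)))
  have hE : ∀ (g : AddValueGroup R L) {x : L}, x ≠ 0 → ValuationRing.valuation R L x =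
      (Additive.toMul (OrderDual.ofDual g)).1 → E g = D x := by
    intro g x hx h
    rw [← hr] at h
    obtain ⟨u, hu⟩ := Quotient.exact h
    change u • _ = x at hu
    rw [← hu, hDunit u (hr0 _)]
  have hEle : ∀ g h, E g ≤ E h ↔ g ≤ h := by
    intro g h
    rw [hDle (hr0 _) (hr0 _)]
    -- In the multiplicative value group the value of `y` is at most that of `x` iff `y` is an
    -- `R`-multiple of `x`; the order dual reverses this.
    change _ ↔ (Additive.toMul (OrderDual.ofDual h)).1 ≤ (Additive.toMul (OrderDual.ofDual g)).1
    rw [← hr, ← hr]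
    rfl
  -- Antisymmetry is taken in the value group, since `Γ` is only preordered.
  have hEinj : Function.Injective E := fun g h hgh =>
    le_antisymm ((hEle g h).1 hgh.le) ((hEle h g).1 hgh.ge)
  have hEsurj : Function.Surjective E := by
    intro γ
    obtain ⟨x, y, hx, hy, h⟩ := hsurj γ
    have hxy := div_ne_zero (hne hx) (hne hy)
    refine ⟨OrderDual.toDual (Additive.ofMul (Units.mk0
      (ValuationRing.valuation R L (algebraMap R L x / algebraMap R L y))
      ((Valuation.ne_zero_iff _).2 hxy))), ?_⟩
    rw [hE _ hxy rfl, hD hx hy, h, add_sub_cancel_right]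
  have hEadd : ∀ g h, E (g + h) = E g + E h := by
    intro g h
    rw [hE (g + h) (x := r (Additive.toMul (OrderDual.ofDual g)) *
      r (Additive.toMul (OrderDual.ofDual h))) (mul_ne_zero (hr0 _) (hr0 _))
      (by rw [map_mul, hr, hr]; rfl), hDmul (hr0 _) (hr0 _)]
  exact ⟨{ Equiv.ofBijective E ⟨hEinj, hEsurj⟩ with
    map_add' := hEadd
    map_le_map_iff' := fun {g h} => hEle g h }⟩

/-- The version of `nonempty_addValueGroup_orderAddIso` for a localization that is a valuation
ring. -/
theorem nonempty_addValueGroup_localization_orderAddIso {B L : Type*} [CommRing B] [IsDomain B]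
    (m : Ideal B) [m.IsPrime] [IsDomain (Localization.AtPrime m)]
    [ValuationRing (Localization.AtPrime m)] [Field L] [Algebra (Localization.AtPrime m) L]
    [IsFractionRing (Localization.AtPrime m) L] (ν : B → Γ)
    (hmul : ∀ x y, x ≠ 0 → y ≠ 0 → ν (x * y) = ν x + ν y)
    (hle : ∀ x y, x ≠ 0 → y ≠ 0 → (ν x ≤ ν y ↔ ∃ t ∉ m, x ∣ t * y))
    (hunit : ∀ t ∉ m, ν t = 0)
    (hsurj : ∀ γ, ∃ x y, x ≠ 0 ∧ y ≠ 0 ∧ ν x = γ + ν y) :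
    Nonempty (AddValueGroup (Localization.AtPrime m) L ≃+o Γ) := by
  let R := Localization.AtPrime m
  have hinj : Function.Injective (algebraMap B R) :=
    IsLocalization.injective R m.primeCompl_le_nonZeroDivisors
  have hne : ∀ {x : B}, x ≠ 0 → algebraMap B R x ≠ 0 := fun hx =>
    (map_ne_zero_iff _ hinj).2 hx
  choose f hf using fun x : R => IsLocalization.surj m.primeCompl x
  have hf0 : ∀ {x : R}, x ≠ 0 → (f x).1 ≠ 0 := by
    intro x hx h
    have := hf x
    rw [h, map_zero] at this
    exact mul_ne_zero hx (IsLocalization.map_units R (f x).2).ne_zero this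
  have hs0 : ∀ {s : B}, s ∉ m → s ≠ 0 := by
    rintro s hs rfl
    exact hs m.zero_mem
  -- Denominators have value `0`, so the value of a fraction is that of any of its numerators.
  have key : ∀ {x : R} {y s : B}, y ≠ 0 → s ∉ m → x * algebraMap B R s = algebraMap B R y →
      ν (f x).1 = ν y := by
    intro x y s hy hs h
    have hx : x ≠ 0 := by
      rintro rfl
      rw [zero_mul] at h
      exact hne hy h.symm
    have h1 : (f x).1 * s = y * (f x).2 := by
      apply hinj
      rw [map_mul, map_mul, ← hf, ← h]
      ring
    have h2 := congrArg ν h1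
    rwa [hmul _ _ (hf0 hx) (hs0 hs), hmul _ _ hy (hs0 (f x).2.2), hunit s hs, hunit _ (f x).2.2,
      add_zero, add_zero] at h2
  refine nonempty_addValueGroup_orderAddIso (R := R) (fun x => ν (f x).1) ?_ ?_ ?_ ?_
  · intro x y hx hy
    rw [← hmul _ _ (hf0 hx) (hf0 hy)]
    refine key (mul_ne_zero (hf0 hx) (hf0 hy)) ((f x).2 * (f y).2).2 ?_
    rw [map_mul, ← hf, ← hf, Submonoid.coe_mul, map_mul]
    ring
  · intro x y hx hy
    rw [hle _ _ (hf0 hx) (hf0 hy)]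
    have hux := IsLocalization.map_units R (f x).2
    have huy := IsLocalization.map_units R (f y).2
    have h1 : x ∣ y ↔ algebraMap B R (f x).1 ∣ algebraMap B R (f y).1 := by
      rw [← hf, ← hf, hux.mul_right_dvd, huy.dvd_mul_right]
    rw [h1]
    constructor
    · rintro ⟨t, ht, h⟩
      have := map_dvd (algebraMap B R) h
      rw [map_mul] at this
      exact (IsLocalization.map_units R (⟨t, ht⟩ : m.primeCompl)).dvd_mul_left.1 this
    · rintro ⟨c, hc⟩
      refine ⟨(f c).2, (f c).2.2, (f c).1, hinj ?_⟩
      rw [map_mul, map_mul, hc, ← hf c]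
      ring
  · intro w
    refine hunit _ ((IsLocalization.AtPrime.isUnit_to_map_iff R m (f w).1).1 ?_)
    rw [← hf]
    exact w.isUnit.mul (IsLocalization.map_units R (f w).2)
  · intro γ
    obtain ⟨x, y, hx, hy, h⟩ := hsurj γ
    have h1 : (1 : B) ∉ m := m.one_notMem
    refine ⟨algebraMap B R x, algebraMap B R y, hne hx, hne hy, ?_⟩
    rw [key hx h1 (by rw [map_one, mul_one]), key hy h1 (by rw [map_one, mul_one]), h]

end ValueGroup

namespace NonstandardExtension

variable {S : NonstandardExtension.{u, v}}

/-! ### The filter attached to `m`: properness, maximality, valuation -/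

section Filter

open Internal

variable {I : Type u} {A : I → Type u} [∀ i, CommRing (A i)] {b : S.obj I}

instance : IsOrderedAddMonoid (ULift.{u} ℤ) where
  add_le_add_left _ _ h c := ULift.down_le.1 (add_le_add_left (ULift.down_le.2 h) c.down)

/-- The filter on `𝓜` generated by the sets `V(a)`, for nonzero `a ∈ m`. -/
def locusFilter (m : Ideal (S.Internal A b)) (hm : m ≠ ⊥) :
    Filter (S.InternalMaximal A b) where
  sets := {U | ∃ t : Finset (S.Internal A b), t.Nonempty ∧ (∀ a ∈ t, a ∈ m ∧ a ≠ 0) ∧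
    ⋂ a ∈ t, zeroLocus a ⊆ U}
  univ_sets := by
    obtain ⟨a, ha, ha0⟩ := Submodule.exists_mem_ne_zero_of_ne_bot hm
    exact ⟨{a}, by simp, by simp [ha, ha0], Set.subset_univ _⟩
  sets_of_superset := by
    rintro U V ⟨t, ht, h, hU⟩ hUV
    exact ⟨t, ht, h, hU.trans hUV⟩
  inter_sets := by
    classical
    rintro U V ⟨t, ht, h, hU⟩ ⟨t', ht', h', hV⟩
    refine ⟨t ∪ t', ht.mono Finset.subset_union_left, fun a ha => ?_, ?_⟩
    · rcases Finset.mem_union.1 ha with ha | ha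
      exacts [h a ha, h' a ha]
    · intro p hp
      rw [Set.mem_iInter₂] at hp
      exact ⟨hU (Set.mem_iInter₂.2 fun a ha => hp a (Finset.mem_union_left _ ha)),
        hV (Set.mem_iInter₂.2 fun a ha => hp a (Finset.mem_union_right _ ha))⟩

variable {m : Ideal (S.Internal A b)}

theorem eventually_mem {hm : m ≠ ⊥} {x : S.Internal A b} (hx : x ∈ m) :
    ∀ᶠ p in locusFilter m hm, x ∈ p.1 := by
  by_cases h : x = 0
  · exact .of_forall fun p => h ▸ p.1.zero_mem
  · exact ⟨{x}, by simp, by simp [hx, h], by simp [zeroLocus]⟩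

/-- An equation `y * x + i = 1` with `i ∈ m` prevents `x ∈ p` as soon as `i ∈ p`. -/
theorem eventually_notMem [hmax : m.IsMaximal] {hm : m ≠ ⊥} {x : S.Internal A b} (hx : x ∉ m) :
    ∀ᶠ p in locusFilter m hm, x ∉ p.1 := by
  obtain ⟨y, i, hi, h⟩ := hmax.exists_inv hx
  filter_upwards [eventually_mem hi] with p hp hxp
  exact p.2.1.ne_top ((Ideal.eq_top_iff_one _).2 (h ▸ p.1.add_mem (p.1.mul_mem_left y hxp) hp))

/-- One nonzero `a` is kept fixed and the other generators are merged, one at a time, into a single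
`x ∈ m` by `exists_add_mul_mem_imp`. The element `x` may be `0`. -/
theorem IsInternalDedekind.exists_zeroLocus_inter_subset (hB : S.IsInternalDedekind A b)
    {hm : m ≠ ⊥} {U : Set (S.InternalMaximal A b)} (hU : U ∈ locusFilter m hm) :
    ∃ a ∈ m, ∃ x ∈ m, a ≠ 0 ∧ zeroLocus a ∩ zeroLocus x ⊆ U := by
  classical
  obtain ⟨t, ⟨a, hat⟩, ht, htU⟩ := hU
  have key : ∀ t' : Finset (S.Internal A b), (∀ y ∈ t', y ∈ m) →
      ∃ x ∈ m, ∀ p ∈ zeroLocus a, x ∈ p.1 → ∀ y ∈ t', y ∈ p.1 := by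
    intro t'
    induction t' using Finset.induction_on with
    | empty => exact fun _ => ⟨0, m.zero_mem, by simp⟩
    | insert z t' _ ih =>
      intro h
      obtain ⟨x, hx, hxt⟩ := ih fun y hy => h y (Finset.mem_insert_of_mem hy)
      obtain ⟨c, hc⟩ := hB.exists_add_mul_mem_imp (ht a hat).2 x z
      refine ⟨x + c * z, m.add_mem hx (m.mul_mem_left c (h z (Finset.mem_insert_self z t'))),
        fun p hp hxz y hy => ?_⟩
      obtain ⟨h1, h2⟩ := hc p hp hxz
      rcases Finset.mem_insert.1 hy with rfl | hy
      exacts [h2, hxt p hp h1 y hy]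
  obtain ⟨x, hx, h⟩ := key t fun y hy => (ht y hy).1
  refine ⟨a, (ht a hat).1, x, hx, (ht a hat).2, fun p hp => htU ?_⟩
  exact Set.mem_iInter₂.2 fun y hy => h p hp.1 hp.2 y hy

theorem IsInternalDedekind.locusFilter_neBot (hB : S.IsInternalDedekind A b) [hmax : m.IsMaximal]
    {hm : m ≠ ⊥} : (locusFilter m hm).NeBot := by
  refine Filter.neBot_iff.2 fun hbot => ?_
  have h : ∅ ∈ locusFilter m hm := Filter.empty_mem_iff_bot.2 hbot
  obtain ⟨a, ha, x, hx, -, hax⟩ := hB.exists_zeroLocus_inter_subset h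
  obtain ⟨p, hp⟩ := exists_internalMaximal_mem (a := a) (x := x) fun c d hcd => hmax.ne_top
    ((Ideal.eq_top_iff_one _).2 (hcd ▸ m.add_mem (m.mul_mem_left c ha) (m.mul_mem_left d hx)))
  exact hax hp

/-- The filter on `𝓛` generated by the sets `V(a)`, for nonzero `a ∈ m`. -/
def IsInternalDedekind.locusPFilter (hB : S.IsInternalDedekind A b) (hm : m ≠ ⊥) :
    Order.PFilter (S.HyperfiniteSets A b) :=
  Order.IsPFilter.toPFilter (F := {H | H.1 ∈ locusFilter m hm}) <| by
    refine Order.IsPFilter.of_def ?_ ?_ ?_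
    · obtain ⟨a, ha, ha0⟩ := Submodule.exists_mem_ne_zero_of_ne_bot hm
      exact ⟨⟨zeroLocus a, hB.isHyperfinite_zeroLocus ha0⟩, eventually_mem (hm := hm) ha⟩
    · intro H (hH : H.1 ∈ locusFilter m hm) K (hK : K.1 ∈ locusFilter m hm)
      exact ⟨⟨H.1 ∩ K.1, H.2.inter K.2⟩, (Filter.inter_mem hH hK : _ ∈ locusFilter m hm),
        Set.inter_subset_left, Set.inter_subset_right⟩
    · intro H K h (hH : H.1 ∈ locusFilter m hm)
      exact (Filter.mem_of_superset hH h : _ ∈ locusFilter m hm)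

theorem IsInternalDedekind.mem_locusPFilter (hB : S.IsInternalDedekind A b) {hm : m ≠ ⊥}
    {H : S.HyperfiniteSets A b} : H ∈ hB.locusPFilter hm ↔ H.1 ∈ locusFilter m hm := Iff.rfl

/-- The filter on `𝓜` has a basis of hyperfinite sets `V(a) ∩ V(x)`, so that working modulo `𝓕` is
the same as working eventually along it. -/
theorem IsInternalDedekind.exists_mem_locusPFilter_iff (hB : S.IsInternalDedekind A b)
    {hm : m ≠ ⊥} {P : S.InternalMaximal A b → Prop} :
    (∃ H ∈ hB.locusPFilter hm, ∀ p ∈ H.1, P p) ↔ ∀ᶠ p in locusFilter m hm, P p := by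
  constructor
  · rintro ⟨H, hH, h⟩
    exact Filter.mem_of_superset hH h
  · intro h
    obtain ⟨a, ha, x, hx, ha0, hax⟩ := hB.exists_zeroLocus_inter_subset h
    have hV : IsHyperfinite (zeroLocus a ∩ zeroLocus x) := by
      by_cases hx0 : x = 0
      · have : zeroLocus (0 : S.Internal A b) = Set.univ :=
          Set.eq_univ_of_forall fun p => p.1.zero_mem
        rw [hx0, this, Set.inter_univ]
        exact hB.isHyperfinite_zeroLocus ha0
      · exact (hB.isHyperfinite_zeroLocus ha0).inter (hB.isHyperfinite_zeroLocus hx0)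
    exact ⟨⟨_, hV⟩, hB.mem_locusPFilter.2 (Filter.inter_mem (eventually_mem ha) (eventually_mem hx)),
      fun p hp => hax hp⟩

/-- Let `H` be outside the filter and separate `V(a)` along `H` by `e + f = 1`. If `e ∈ m`, then
`V(a) ∩ V(e) ⊆ H` would put `H` into the filter. Hence `f ∈ m`, and `V(a) ∩ V(f)` is disjoint from
`H`. A larger filter containing `H` thus contains `∅`. -/
theorem IsInternalDedekind.isUltrafilterOf (hB : S.IsInternalDedekind A b) [hmax : m.IsMaximal]
    (hm : m ≠ ⊥) : IsUltrafilterOf m (hB.locusPFilter hm) := by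
  refine ⟨?_, fun H => Iff.rfl⟩
  have hbot := hB.locusFilter_neBot (hm := hm)
  have hproper : (hB.locusPFilter hm).dual.IsProper := by
    refine ⟨fun h => ?_⟩
    have h0 : OrderDual.toDual (⟨∅, isHyperfinite_empty⟩ : S.HyperfiniteSets A b) ∈
        ((hB.locusPFilter hm).dual : Set _) := h ▸ Set.mem_univ _
    exact Filter.empty_notMem (locusFilter m hm) h0
  refine ⟨fun J hJ => Set.eq_univ_of_forall fun K => ?_⟩
  obtain ⟨H, hHJ, hH⟩ := SetLike.exists_of_lt hJ
  replace hH : (OrderDual.ofDual H).1 ∉ locusFilter m hm := hH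
  obtain ⟨a, ha, ha0⟩ := Submodule.exists_mem_ne_zero_of_ne_bot hm
  obtain ⟨e, f, hef, ⟨d, hd⟩, hsep⟩ := hB.exists_separation ha0 (OrderDual.ofDual H).2
  have hJmem : ∀ {H' : S.HyperfiniteSets A b}, H'.1 ∈ locusFilter m hm → OrderDual.toDual H' ∈ J :=
    fun h => hJ.le h
  have hfm : f ∈ m := by
    have hor : e ∈ m ∨ f ∈ m := hmax.isPrime.mem_or_mem (by
      rw [hd]
      exact m.mul_mem_right d ha)
    refine hor.resolve_left fun he => hH ?_
    filter_upwards [eventually_mem he, eventually_mem ha] with p hpe hpa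
    by_contra hpH
    exact p.2.1.ne_top ((Ideal.eq_top_iff_one _).2
      (hef ▸ p.1.add_mem hpe ((hsep p hpa).2 hpH)))
  obtain ⟨V, hV, hVf⟩ := (hB.exists_mem_locusPFilter_iff (hm := hm)).2
    ((eventually_mem hfm).and (eventually_mem ha))
  -- In the dual order `W` is a common subset of `H` and `V`, hence empty, and every `K` lies above
  -- it.
  obtain ⟨W, hW, h1, h2⟩ := J.directed _ hHJ _ (hJmem hV)
  refine J.lower ?_ hW
  change (OrderDual.ofDual W).1 ⊆ (OrderDual.ofDual K).1
  intro p hp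
  have hpH := h1 hp
  obtain ⟨hpf, hpa⟩ := hVf p (h2 hp)
  exact (p.2.1.ne_top ((Ideal.eq_top_iff_one _).2
    (hef ▸ p.1.add_mem ((hsep p hpa).1 hpH) hpf))).elim

/-- The point `m` lies in every `V(a)` with `a ∈ m`, and the loci of two generators of `m` intersect
in this point alone. -/
theorem IsInternalDedekind.eventually_locusFilter_iff (hB : S.IsInternalDedekind A b)
    [hmax : m.IsMaximal] (hm : m ≠ ⊥) (hint : IsInternal (m : Set (S.Internal A b)))
    {P : S.InternalMaximal A b → Prop} :
    (∀ᶠ p in locusFilter m hm, P p) ↔ P ⟨m, hmax, hint⟩ := by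
  constructor
  · rintro ⟨t, -, ht, htP⟩
    exact htP (Set.mem_iInter₂.2 fun a ha => (ht a ha).1)
  · intro h
    obtain ⟨a, x, -, ha, hx, hax⟩ := hB.exists_two_generators ⟨m, hmax, hint⟩
    filter_upwards [eventually_mem ha, eventually_mem hx] with p hpa hpx
    rwa [← hax p hpa hpx]

/-- The right side says that `x` divides `y` in `B_m`. With `s + t = 1`, `s * x = y * d` and `x ∣ t
* y`, one of `t`, `d` serves as multiplier unless both lie in `m`. In that case `s ∉ m`, and at
almost all `p` one has `s ∉ p` and `d ∈ p`, so `x` has strictly larger order than `y`. -/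
theorem IsInternalDedekind.eventually_order_le_iff (hB : S.IsInternalDedekind A b)
    [hmax : m.IsMaximal] (hm : m ≠ ⊥) {x y : S.Internal A b} (hx : x ≠ 0) (hy : y ≠ 0) :
    (∀ᶠ p in locusFilter m hm, p.order x ≤ p.order y) ↔ ∃ t ∉ m, x ∣ t * y := by
  have := hB.locusFilter_neBot (hm := hm)
  constructor
  · intro h
    obtain ⟨s, t, hst, ⟨d, hd⟩, ht⟩ := hB.exists_add_eq_one_and_dvd_mul x y
    by_cases htm : t ∈ m
    swap
    · exact ⟨t, htm, ht⟩
    have hsm : s ∉ m := fun hsm => hmax.ne_top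
      ((Ideal.eq_top_iff_one _).2 (hst ▸ m.add_mem hsm htm))
    by_cases hdm : d ∈ m
    swap
    · exact ⟨d, hdm, s, by rw [mul_comm d, ← hd, mul_comm]⟩
    obtain ⟨p, h1, h2, h3⟩ :=
      (h.and ((eventually_notMem (hm := hm) hsm).and (eventually_mem hdm))).exists
    exact (p.not_order_le hB hy hx h2 h3 hd h1).elim
  · rintro ⟨t, ht, d, hd⟩
    filter_upwards [eventually_notMem ht] with p hp
    exact p.order_le hB hx hy hp hd

theorem IsInternalDedekind.isDomain_localization (hB : S.IsInternalDedekind A b) [m.IsPrime] :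
    IsDomain (Localization.AtPrime m) :=
  have := hB.isDomain
  IsLocalization.isDomain_localization m.primeCompl_le_nonZeroDivisors

/-- Of two elements with sum `1`, one lies outside `m` and becomes a unit. The arithmetical property
then makes divisibility in `B_m` total. -/
theorem IsInternalDedekind.valuationRing_localization (hB : S.IsInternalDedekind A b)
    [hmax : m.IsMaximal] [IsDomain (Localization.AtPrime m)] :
    ValuationRing (Localization.AtPrime m) := by
  rw [ValuationRing.iff_dvd_total]
  refine ⟨fun x y => ?_⟩
  obtain ⟨⟨x', s⟩, hs⟩ := IsLocalization.surj m.primeCompl x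
  obtain ⟨⟨y', s'⟩, hs'⟩ := IsLocalization.surj m.primeCompl y
  have key : ∀ {x y : Localization.AtPrime m} {x' y' c : S.Internal A b} {s s' : m.primeCompl},
      x * algebraMap _ _ s.1 = algebraMap _ _ x' → y * algebraMap _ _ s'.1 = algebraMap _ _ y' →
      c ∉ m → x' ∣ c * y' → x ∣ y := by
    intro x y x' y' c s s' hs hs' hc h
    have h1 := map_dvd (algebraMap _ (Localization.AtPrime m)) h
    rw [map_mul, ← hs, ← hs', (IsLocalization.map_units _ s).mul_right_dvd] at h1
    rw [(IsLocalization.map_units _ (⟨c, hc⟩ : m.primeCompl)).dvd_mul_left] at h1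
    exact (IsLocalization.map_units _ s').dvd_mul_right.1 h1
  obtain ⟨c, d, hcd, h1, h2⟩ := hB.exists_add_eq_one_and_dvd_mul x' y'
  by_cases hc : c ∈ m
  · refine Or.inl (key hs hs' (c := d) (fun hd => hmax.ne_top ?_) h2)
    exact (Ideal.eq_top_iff_one _).2 (hcd ▸ m.add_mem hc hd)
  · exact Or.inr (key hs' hs hc h1)

end Filter

/-! ### Identification of the value group -/

section DivisorsMod

open Internal

variable {I : Type u} {A : I → Type u} [∀ i, CommRing (A i)] {b : S.obj I}

namespace DivisorsMod

variable {𝓕 : Order.PFilter (S.HyperfiniteSets A b)}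

theorem mk_surjective : Function.Surjective (mk : S.weilDivisors A b → DivisorsMod 𝓕) :=
  QuotientAddGroup.mk_surjective

theorem mk_add (f g : S.weilDivisors A b) : (mk (f + g) : DivisorsMod 𝓕) = mk f + mk g := rfl

theorem mk_le_mk_iff (f g : S.weilDivisors A b) :
    (mk f : DivisorsMod 𝓕) ≤ mk g ↔ ∃ H ∈ 𝓕, ∀ p ∈ H.1, f.1 p ≤ g.1 p := by
  constructor
  · rintro ⟨f', g', hf, hg, H, hH, h⟩
    obtain ⟨K, hK, h1⟩ := (mk_eq_mk_iff _ _).1 hf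
    obtain ⟨J, hJ, h2⟩ := (mk_eq_mk_iff _ _).1 hg
    obtain ⟨M, hM, hMH, hMK⟩ := 𝓕.directed H hH K hK
    obtain ⟨N, hN, hNM, hNJ⟩ := 𝓕.directed M hM J hJ
    refine ⟨N, hN, fun p hp => ?_⟩
    rw [← h1 p (hMK (hNM hp)), ← h2 p (hNJ hp)]
    exact h p (hMH (hNM hp))
  · exact fun h => ⟨f, g, rfl, rfl, h⟩

instance : IsOrderedAddMonoid (DivisorsMod 𝓕) where
  add_le_add_left x y h z := by
    obtain ⟨f, rfl⟩ := mk_surjective x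
    obtain ⟨g, rfl⟩ := mk_surjective y
    obtain ⟨k, rfl⟩ := mk_surjective z
    rw [← mk_add, ← mk_add, mk_le_mk_iff]
    obtain ⟨H, hH, h⟩ := (mk_le_mk_iff _ _).1 h
    exact ⟨H, hH, fun p hp => add_le_add_left (h p hp) _⟩

end DivisorsMod

theorem IsInternalDedekind.order_mem_weilDivisors (hB : S.IsInternalDedekind A b)
    {a : S.Internal A b} (ha : a ≠ 0) :
    (fun p : S.InternalMaximal A b => p.order a) ∈ S.weilDivisors A b := by
  refine ⟨isInternalFun_iff.2 ⟨Internal.map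
    (fun _ a s => ULift.up (idealOrder s a : ℤ)) a, fun p => ?_⟩,
    zeroLocus a, hB.isHyperfinite_zeroLocus ha, fun p hp => p.order_eq_zero hB hp⟩
  obtain ⟨w, rfl, hw⟩ := Internal.exists_pair a p.code
  rw [p.order_map hw, ← hw, Internal.map_map, Internal.map₂_map_map]

theorem isInternalFun_const (z : S.HyperInt) :
    IsInternalFun (fun _ : S.InternalMaximal A b => z) := by
  obtain ⟨y, rfl⟩ := exists_toStar_eq (b := b) z
  refine isInternalFun_iff.2 ⟨Internal.map (fun _ z _ => z) y, fun p => ?_⟩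
  obtain ⟨w, rfl, hw⟩ := Internal.exists_pair y p.code
  rw [← hw, Internal.map_map, Internal.map₂_map_map]

variable {m : Ideal (S.Internal A b)} [hmax : m.IsMaximal]
  {L : Type*} [Field L] [Algebra (Localization.AtPrime m) L]
  [IsFractionRing (Localization.AtPrime m) L] [IsDomain (Localization.AtPrime m)]
  [ValuationRing (Localization.AtPrime m)]

theorem IsInternalDedekind.nonempty_orderAddIso_divisorsMod (hB : S.IsInternalDedekind A b)
    (hm : m ≠ ⊥) : Nonempty (AddValueGroup (Localization.AtPrime m) L ≃+o
      DivisorsMod (hB.locusPFilter hm)) := by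
  classical
  have := hB.isDomain
  let D : {a : S.Internal A b // a ≠ 0} → S.weilDivisors A b :=
    fun a => ⟨_, hB.order_mem_weilDivisors a.2⟩
  let ν : S.Internal A b → DivisorsMod (hB.locusPFilter hm) := fun a =>
    if ha : a ≠ 0 then DivisorsMod.mk (D ⟨a, ha⟩) else 0
  have hν : ∀ {a} (ha : a ≠ 0), ν a = DivisorsMod.mk (D ⟨a, ha⟩) := fun ha => dif_pos ha
  refine nonempty_addValueGroup_localization_orderAddIso m ν ?_ ?_ ?_ ?_
  · intro x y hx hy
    rw [hν hx, hν hy, hν (mul_ne_zero hx hy), ← DivisorsMod.mk_add]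
    congr 1
    exact Subtype.ext (funext fun p => p.order_mul hB hx hy)
  · intro x y hx hy
    rw [hν hx, hν hy, DivisorsMod.mk_le_mk_iff, hB.exists_mem_locusPFilter_iff]
    exact hB.eventually_order_le_iff hm hx hy
  · intro t ht
    have ht0 : t ≠ 0 := fun h => ht (h ▸ m.zero_mem)
    rw [hν ht0]
    change _ = DivisorsMod.mk 0
    rw [DivisorsMod.mk_eq_mk_iff, hB.exists_mem_locusPFilter_iff]
    filter_upwards [eventually_notMem ht] with p hp
    exact p.order_eq_zero hB hp
  · intro γ
    obtain ⟨f, rfl⟩ := DivisorsMod.mk_surjective γ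
    obtain ⟨c, hc, hc0⟩ := Submodule.exists_mem_ne_zero_of_ne_bot hm
    obtain ⟨x, y, hx, hy, h⟩ := hB.exists_order_eq hc0 f.2.1
    refine ⟨x, y, hx, hy, ?_⟩
    rw [hν hx, hν hy, ← DivisorsMod.mk_add, DivisorsMod.mk_eq_mk_iff,
      hB.exists_mem_locusPFilter_iff]
    filter_upwards [eventually_mem hc] with p hp
    exact h p hp

/-- Since the filter is principal, comparing orders almost everywhere means comparing them at `m`.
Surjectivity comes from approximating constant functions on some `V(c)` with `c ∈ m`. -/
theorem IsInternalDedekind.nonempty_orderAddIso_hyperInt (hB : S.IsInternalDedekind A b)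
    (hint : IsInternal (m : Set (S.Internal A b))) :
    Nonempty (AddValueGroup (Localization.AtPrime m) L ≃+o S.HyperInt) := by
  have := hB.isDomain
  have hm := hB.ne_bot m
  let p : S.InternalMaximal A b := ⟨m, hmax, hint⟩
  refine nonempty_addValueGroup_localization_orderAddIso m p.order
    (fun x y => p.order_mul hB) (fun x y hx hy => ?_) (fun t => p.order_eq_zero hB) fun z => ?_
  · rw [← hB.eventually_order_le_iff hm hx hy, hB.eventually_locusFilter_iff hm hint]
  · obtain ⟨c, hc, hc0⟩ := Submodule.exists_mem_ne_zero_of_ne_bot hm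
    obtain ⟨x, y, hx, hy, h⟩ := hB.exists_order_eq hc0 (isInternalFun_const z)
    exact ⟨x, y, hx, hy, h p hc⟩

end DivisorsMod

end NonstandardExtension

theorem mainTheorem5 (S : NonstandardExtension.{u, v}) {I : Type u} (A : I → Type u)
    [∀ i, CommRing (A i)] (b : S.obj I) (hB : S.IsInternalDedekind A b)
    (m : Ideal (S.Internal A b)) [m.IsMaximal]
    (L : Type*) [Field L] [Algebra (Localization.AtPrime m) L]
    [IsFractionRing (Localization.AtPrime m) L] :
    ∃ (_ : IsDomain (Localization.AtPrime m)) (_ : ValuationRing (Localization.AtPrime m))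
      (𝓕 : Order.PFilter (S.HyperfiniteSets A b)),
      NonstandardExtension.IsUltrafilterOf m 𝓕 ∧
      Nonempty (AddValueGroup (Localization.AtPrime m) L ≃+o
        NonstandardExtension.DivisorsMod 𝓕) ∧
      ∀ hm : NonstandardExtension.IsInternal (m : Set (S.Internal A b)),
        (∀ H : S.HyperfiniteSets A b, H ∈ 𝓕 ↔ ⟨m, inferInstance, hm⟩ ∈ H.1) ∧
        Nonempty (AddValueGroup (Localization.AtPrime m) L ≃+o S.HyperInt) := by
  have hdom := hB.isDomain_localization (m := m)
  have hval := hB.valuationRing_localization (m := m)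
  have hm := hB.ne_bot m
  exact ⟨hdom, hval, hB.locusPFilter hm, hB.isUltrafilterOf hm,
    hB.nonempty_orderAddIso_divisorsMod hm, fun hint =>
      ⟨fun H => hB.eventually_locusFilter_iff hm hint (P := fun p => p ∈ H.1),
        hB.nonempty_orderAddIso_hyperInt hint⟩⟩
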